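/- Let $n\ge 1$, $\alpha\in(0,1)$ and $p\in\left(\frac1{1-\alpha},+\infty\right]$, and set $\mu_{n,\alpha}=2^\alpha\pi^{-n/2}\,\Gamma\!\left(\frac{n+\alpha+1}2\right)/\Gamma\!\left(\frac{1-\alpha}2\right)$. For a Lipschitz vector field $\varphi:\mathbb R^n\to\mathbb R^n$ with compact support, and for a function $g:\mathbb R^n\to\mathbb R$ which is Lipschitz with compact support or the characteristic function of a ball, let $$\operatorname{div}^\alpha\varphi(x)=\mu_{n,\alpha}\lim_{\varepsilon\to0^+}\int_{\{|y|>\varepsilon\}}\frac{y\cdot\varphi(x+y)}{|y|^{n+\alpha+1}}\,dy,\qquad \nabla^\alpha g(x)=\mu_{n,\alpha}\lim_{\varepsilon\to0^+}\int_{\{|y|>\varepsilon\}}\frac{y\,g(x+y)}{|y|^{n+\alpha+1}}\,dy,$$ $$\operatorname{div}^\alpha_{\rm NL}(g,\varphi)(x)=\mu_{n,\alpha}\int_{\mathbb R^n}\frac{(y-x)\cdot(\varphi(y)-\varphi(x))\,(g(y)-g(x))}{|y-x|^{n+\alpha+1}}\,dy$$ (for $g=\chi_{B_r(x_0)}$ the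 limit defining $\nabla^\alpha g$ exists at every point outside $\partial B_r(x_0)$, hence almost everywhere). A function $f$ belongs to $BV^{\alpha,p}(\mathbb R^n)$ if $f\in L^p(\mathbb R^n)$ and $$|D^\alpha f|(\mathbb R^n)=\sup\left\{\int_{\mathbb R^n}f\operatorname{div}^\alpha\varphi\,dx:\ \varphi\in C^\infty_c(\mathbb R^n;\mathbb R^n),\ \|\varphi\|_{L^\infty}\le1\right\}<+\infty ;$$ its fractional variation measure $D^\alpha f$ is then the unique finite $\mathbb R^n$-valued Radon measure such that $\int_{\mathbb R^n}f\operatorname{div}^\alpha\varphi\,dx=-\int_{\mathbb R^n}\varphi\cdot dD^\alpha f$ for all $\varphi\in C^\infty_c(\mathbb R^n;\mathbb R^n)$. **Theorem (integration by parts on balls).** Let $f\in BV^{\alpha,p}(\mathbb R^n)$, let $\varphi:\mathbb R^n\to\mathbb R^n$ be Lipschitz with compact support, and let $x\in\mathbb R^n$. Then, for $\mathscr L^1$-a.e. $r>0$, all four integrals below are absolutely convergent and $$\int_{B_r(x)}f\operatorname{div}^\alpha\varphi\,dy+\int_{\mathbb R^n}f\,\varphi\cdot\nabla^\alpha\chi_{B_r(x)}\,dy+\int_{\mathbb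 R^n}f\operatorname{div}^\alpha_{\rm NL}(\chi_{B_r(x)},\varphi)\,dy=-\int_{B_r(x)}\varphi\cdot dD^\alpha f ,$$ where $B_r(x)$ is the open Euclidean ball with centre $x$ and radius $r$. -/

import Mathlib

open MeasureTheory Set Filter
open scoped Topology ENNReal

noncomputable section

namespace FracBV

/-- The normalization constant `μ_{n,α} = 2^α π^{-n/2} Γ((n+α+1)/2) / Γ((1-α)/2)`. -/
def mu (n : ℕ) (α : ℝ) : ℝ :=
  (2 : ℝ) ^ α * Real.pi ^ (-(n : ℝ) / 2) * Real.Gamma (((n : ℝ) + α + 1) / 2)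
    / Real.Gamma ((1 - α) / 2)

/-- The fractional gradient
`∇^α g (x) = μ_{n,α} lim_{ε → 0+} ∫_{|y| > ε} y g(x + y) / |y|^{n+α+1} dy`.
The limit exists for every `x` if `g` is Lipschitz with compact support; if `g` is the
characteristic function of a ball, it exists for every `x` outside the boundary sphere. -/
def fracGrad {n : ℕ} (α : ℝ) (g : EuclideanSpace ℝ (Fin n) → ℝ)
    (x : EuclideanSpace ℝ (Fin n)) : EuclideanSpace ℝ (Fin n) :=
  mu n α • limUnder (𝓝[>] (0 : ℝ)) (fun ε : ℝ =>
    ∫ y in {y : EuclideanSpace ℝ (Fin n) | ε < ‖y‖},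
      (g (x + y) / ‖y‖ ^ ((n : ℝ) + α + 1)) • y)

/-- The fractional divergence
`div^α φ (x) = μ_{n,α} lim_{ε → 0+} ∫_{|y| > ε} y · φ(x + y) / |y|^{n+α+1} dy`.
The limit exists for every `x` if `φ` is Lipschitz with compact support. -/
def fracDiv {n : ℕ} (α : ℝ) (φ : EuclideanSpace ℝ (Fin n) → EuclideanSpace ℝ (Fin n))
    (x : EuclideanSpace ℝ (Fin n)) : ℝ :=
  mu n α * limUnder (𝓝[>] (0 : ℝ)) (fun ε : ℝ =>
    ∫ y in {y : EuclideanSpace ℝ (Fin n) | ε < ‖y‖},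
      inner ℝ y (φ (x + y)) / ‖y‖ ^ ((n : ℝ) + α + 1))

/-- The non-local divergence
`div^α_NL (g, φ) (x)
  = μ_{n,α} ∫ (y - x) · (φ(y) - φ(x)) (g(y) - g(x)) / |y - x|^{n+α+1} dy`. -/
def fracDivNL {n : ℕ} (α : ℝ) (g : EuclideanSpace ℝ (Fin n) → ℝ)
    (φ : EuclideanSpace ℝ (Fin n) → EuclideanSpace ℝ (Fin n))
    (x : EuclideanSpace ℝ (Fin n)) : ℝ :=
  mu n α * ∫ y : EuclideanSpace ℝ (Fin n),
    inner ℝ (y - x) (φ y - φ x) * (g y - g x) / ‖y - x‖ ^ ((n : ℝ) + α + 1)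

/-- The total fractional variation `|D^α f|(ℝⁿ)`: the supremum of `∫ f div^α φ dx` over all
smooth compactly supported vector fields `φ` with `‖φ‖_∞ ≤ 1`. The competitor `φ = 0` gives the
value `0`, so replacing negative values by `0` does not change the supremum. -/
def fracVariation {n : ℕ} (α : ℝ) (f : EuclideanSpace ℝ (Fin n) → ℝ) : ℝ≥0∞ :=
  ⨆ (φ : EuclideanSpace ℝ (Fin n) → EuclideanSpace ℝ (Fin n))
    (_ : ContDiff ℝ (⊤ : ℕ∞) φ) (_ : HasCompactSupport φ) (_ : ∀ x, ‖φ x‖ ≤ 1),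
    ENNReal.ofReal (∫ x, f x * fracDiv α φ x)

/-- Membership in `BV^{α,p}(ℝⁿ)`: `f ∈ L^p(ℝⁿ)` and `|D^α f|(ℝⁿ) < ∞`. -/
def MemBV {n : ℕ} (α : ℝ) (p : ℝ≥0∞) (f : EuclideanSpace ℝ (Fin n) → ℝ) : Prop :=
  MemLp f p volume ∧ fracVariation α f < ⊤

/-- `D` is a finite `ℝⁿ`-valued (Radon) measure with `∫ f div^α φ dx = - ∫ φ · dD` for all
smooth compactly supported vector fields `φ`. -/
def IsFracDerivative {n : ℕ} (α : ℝ) (f : EuclideanSpace ℝ (Fin n) → ℝ)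
    (D : VectorMeasure (EuclideanSpace ℝ (Fin n)) (EuclideanSpace ℝ (Fin n))) : Prop :=
  IsFiniteMeasure D.variation ∧
  ∀ φ : EuclideanSpace ℝ (Fin n) → EuclideanSpace ℝ (Fin n),
    ContDiff ℝ (⊤ : ℕ∞) φ → HasCompactSupport φ →
      ∫ x, f x * fracDiv α φ x = - ∫ᵛ x, φ x ∂[innerSL ℝ; D]

open Classical in
/-- The fractional variation measure `D^α f`, that is, the unique vector measure with
`IsFracDerivative α f`. Every `f ∈ BV^{α,p}(ℝⁿ)` has one; the value `0` is used for functions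
that have none. -/
def fracDerivative {n : ℕ} (α : ℝ) (f : EuclideanSpace ℝ (Fin n) → ℝ) :
    VectorMeasure (EuclideanSpace ℝ (Fin n)) (EuclideanSpace ℝ (Fin n)) :=
  if h : ∃ D, IsFracDerivative α f D then h.choose else 0

end FracBV

end

noncomputable section

namespace FracBV

/-! Write K(z) = z/|z|^{n+α+1} and χ_s for the characteristic function of B_s(x). By oddness of K
the principal values become integrals of increments, for instance div^α φ(y) = μ ∫ K(z)·(φ(y+z) −
φ(y)) dz. The increment of χ_s φ obeys an exact discrete Leibniz rule with three terms
(`leibniz_divIncr`). Multiplied by f(y), paired with K(z) and integrated in (y,z), they give the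
three integrals on the left. What remains is the defining formula of D^α f for the discontinuous
field χ_s φ, for almost every s.

That formula is obtained by averaging in the radius. The radii for which B_s(x) separates a from b
form an interval of length at most |a − b| (`integral_abs_chi_sub_le`). This has two consequences.
First, the term with increments of χ_s is integrable in (s,y,z), since min(|z|,1)|K(z)| and f|φ| are
integrable; hence it is integrable in (y,z) for a.e. s. Second, for w ∈ C_c^∞(ℝ) the field (∫ w(s)
χ_s ds) φ is Lipschitz with compact support, and mollification extends the defining formula to such
fields (`IsFracDerivative.integral_eq`). Fubini and the fundamental lemma of the calculus of
variations in s then give the identity for a.e. s (`IsFracDerivative.ae_integral_divIncr_eq`).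

The measure D^α f must also be shown to exist (`exists_isFracDerivative`). The functional φ ↦ ∫ f
div^α φ, bounded because the variation is finite, is extended by Hahn–Banach and represented
coordinatewise by the Riesz theorem for signed functionals. -/

/-- The ambient Euclidean space `ℝⁿ`. -/
abbrev Space (n : ℕ) := EuclideanSpace ℝ (Fin n)

/-! ### The kernel, and principal values as integrals of increments -/

/-- The kernel `z / |z|^{n+α+1}` of the fractional operators. -/
def kernel {n : ℕ} (α : ℝ) (z : Space n) : Space n := (‖z‖ ^ ((n : ℝ) + α + 1))⁻¹ • z

lemma measurable_kernel {n : ℕ} (α : ℝ) : Measurable (kernel α : Space n → Space n) := by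
  unfold kernel; fun_prop

lemma norm_kernel {n : ℕ} (α : ℝ) (z : Space n) :
    ‖kernel α z‖ = (‖z‖ ^ ((n : ℝ) + α + 1))⁻¹ * ‖z‖ := by
  rw [kernel, norm_smul, Real.norm_eq_abs, abs_of_nonneg (by positivity)]

lemma kernel_neg {n : ℕ} (α : ℝ) (z : Space n) : kernel α (-z) = -kernel α z := by
  simp [kernel]

lemma inner_kernel {n : ℕ} (α : ℝ) (z v : Space n) :
    inner ℝ (kernel α z) v = inner ℝ z v / ‖z‖ ^ ((n : ℝ) + α + 1) := by
  rw [kernel, real_inner_smul_left, div_eq_inv_mul]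

lemma smul_kernel {n : ℕ} (α : ℝ) (z : Space n) (c : ℝ) :
    c • kernel α z = (c / ‖z‖ ^ ((n : ℝ) + α + 1)) • z := by
  rw [kernel, smul_smul, div_eq_mul_inv]

/-- In polar coordinates the integrand becomes r^{-α} on (0,1], integrable as α < 1, and r^{-1-α} on
(1,∞), integrable as α > 0. -/
lemma integrable_min_norm_kernel {n : ℕ} (hn : 1 ≤ n) {α : ℝ} (hα0 : 0 < α) (hα1 : α < 1) :
    Integrable (fun z : Space n => min ‖z‖ 1 * ‖kernel α z‖) := by
  have : Nonempty (Fin n) := ⟨⟨0, hn⟩⟩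
  have : Nontrivial (Space n) := inferInstance
  simp_rw [norm_kernel]
  rw [integrable_fun_norm_addHaar volume
    (f := fun r : ℝ => min r 1 * ((r ^ ((n : ℝ) + α + 1))⁻¹ * r))]
  rw [finrank_euclideanSpace_fin]
  have hpow : ∀ r : ℝ, 0 < r → r ^ (n - 1) * ((r ^ ((n : ℝ) + α + 1))⁻¹ * r) = r ^ (-1 - α) := by
    intro r hr
    have h1 : r ^ (n - 1) * r = r ^ (n : ℝ) := by
      rw [← pow_succ, Nat.sub_add_cancel hn, Real.rpow_natCast]
    rw [mul_left_comm, h1, ← Real.rpow_neg hr.le, ← Real.rpow_add hr]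
    congr 1; ring
  rw [← Ioc_union_Ioi_eq_Ioi (zero_le_one' ℝ)]
  refine IntegrableOn.union ?_ ?_
  · have h := (intervalIntegral.intervalIntegrable_rpow' (a := 0) (b := 1)
      (r := -α) (by linarith)).1
    refine h.congr_fun (fun r hr => ?_) measurableSet_Ioc
    have hr0 : 0 < r := hr.1
    simp only [smul_eq_mul, min_eq_left hr.2]
    rw [mul_left_comm, hpow r hr0, ← Real.rpow_one_add' hr0.le (by linarith)]
    congr 1; ring
  · have h := integrableOn_Ioi_rpow_of_lt (a := -1 - α) (c := 1) (by linarith) one_pos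
    refine h.congr_fun (fun r hr => ?_) measurableSet_Ioi
    simp only [smul_eq_mul, min_eq_right (le_of_lt (mem_Ioi.1 hr)), one_mul]
    rw [hpow r (one_pos.trans hr)]

lemma integrableOn_kernel {n : ℕ} (hn : 1 ≤ n) {α : ℝ} (hα0 : 0 < α) (hα1 : α < 1)
    {ε : ℝ} (hε : 0 < ε) :
    IntegrableOn (kernel α) {z : Space n | ε < ‖z‖} := by
  have hm : 0 < min ε 1 := lt_min hε one_pos
  refine (((integrable_min_norm_kernel hn hα0 hα1).const_mul (min ε 1)⁻¹).integrableOn).mono'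
    (measurable_kernel α).aestronglyMeasurable ?_
  refine (ae_restrict_iff' (measurableSet_lt measurable_const measurable_norm)).2
    (Eventually.of_forall fun z hz => ?_)
  rw [← mul_assoc, inv_mul_eq_div]
  refine le_mul_of_one_le_left (norm_nonneg _) ?_
  rw [one_le_div hm]
  exact min_le_min_right _ (le_of_lt hz)

lemma setIntegral_kernel {n : ℕ} (α ε : ℝ) :
    ∫ z in {z : Space n | ε < ‖z‖}, kernel α z = 0 := by
  have hs : MeasurableSet {z : Space n | ε < ‖z‖} :=
    measurableSet_lt measurable_const measurable_norm
  rw [← integral_indicator hs]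
  have h := integral_neg_eq_self ({z : Space n | ε < ‖z‖}.indicator (kernel α)) volume
  have h2 : ∀ z, {z : Space n | ε < ‖z‖}.indicator (kernel α) (-z) =
      -{z : Space n | ε < ‖z‖}.indicator (kernel α) z := by
    intro z
    by_cases hz : ε < ‖z‖ <;> simp [hz, kernel_neg]
  simp_rw [h2, integral_neg] at h
  have h3 : (2 : ℝ) • ∫ z, {z : Space n | ε < ‖z‖}.indicator (kernel α) z = 0 := by
    rw [two_smul]
    nth_rewrite 1 [← h]
    exact neg_add_cancel _
  exact (smul_eq_zero.1 h3).resolve_left two_ne_zero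

lemma tendsto_setIntegral_norm_gt {n : ℕ} (hn : 1 ≤ n) {F : Type*} [NormedAddCommGroup F]
    [NormedSpace ℝ F] {G : Space n → F} (hG : Integrable G) :
    Tendsto (fun ε : ℝ => ∫ z in {z : Space n | ε < ‖z‖}, G z) (𝓝[>] 0) (𝓝 (∫ z, G z)) := by
  have : Nonempty (Fin n) := ⟨⟨0, hn⟩⟩
  have hs : ∀ ε : ℝ, MeasurableSet {z : Space n | ε < ‖z‖} := fun ε =>
    measurableSet_lt measurable_const measurable_norm
  simp_rw [← integral_indicator (hs _)]
  refine tendsto_integral_filter_of_dominated_convergence (fun z => ‖G z‖)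
    (Eventually.of_forall fun ε => hG.aestronglyMeasurable.indicator (hs ε))
    (Eventually.of_forall fun ε => Eventually.of_forall fun z => norm_indicator_le_norm_self _ _)
    hG.norm ?_
  filter_upwards [compl_mem_ae_iff.2 (measure_singleton (0 : Space n))] with z hz
  refine tendsto_const_nhds.congr' ?_
  have hz' : 0 < ‖z‖ := norm_pos_iff.2 hz
  filter_upwards [mem_nhdsWithin_of_mem_nhds (Iio_mem_nhds hz')] with ε hε
  exact (indicator_of_mem (s := {z : Space n | ε < ‖z‖}) hε G).symm

/-- The truncated integral of the odd kernel vanishes, so subtracting g(x) changes no truncation;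
dominated convergence then removes the truncation. No regularity of g is needed beyond integrability
of the increments at x, so this also covers balls. -/
lemma fracGrad_eq {n : ℕ} (hn : 1 ≤ n) {α : ℝ} (hα0 : 0 < α) (hα1 : α < 1) {g : Space n → ℝ}
    {x : Space n} (hg : Integrable fun z => (g (x + z) - g x) • kernel α z) :
    fracGrad α g x = mu n α • ∫ z, (g (x + z) - g x) • kernel α z := by
  rw [fracGrad]
  congr 1
  refine Tendsto.limUnder_eq ((tendsto_setIntegral_norm_gt hn hg).congr' ?_)
  filter_upwards [self_mem_nhdsWithin] with ε hε
  have hk : IntegrableOn (fun z => g x • kernel α z) {z : Space n | ε < ‖z‖} :=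
    (integrableOn_kernel hn hα0 hα1 (mem_Ioi.1 hε)).smul (g x)
  have h := integral_add hg.integrableOn hk
  rw [integral_smul, setIntegral_kernel, smul_zero, add_zero] at h
  rw [← h]
  refine integral_congr_ae (Eventually.of_forall fun z => ?_)
  simp only [← smul_kernel]
  rw [← add_smul, sub_add_cancel]

lemma fracDiv_eq {n : ℕ} (hn : 1 ≤ n) {α : ℝ} (hα0 : 0 < α) (hα1 : α < 1)
    {φ : Space n → Space n} {x : Space n}
    (hφ : Integrable fun z => inner ℝ (kernel α z) (φ (x + z) - φ x)) :
    fracDiv α φ x = mu n α * ∫ z, inner ℝ (kernel α z) (φ (x + z) - φ x) := by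
  rw [fracDiv]
  congr 1
  refine Tendsto.limUnder_eq ((tendsto_setIntegral_norm_gt hn hφ).congr' ?_)
  filter_upwards [self_mem_nhdsWithin] with ε hε
  have hk := integrableOn_kernel hn hα0 hα1 (mem_Ioi.1 hε)
  have h := integral_add hφ.integrableOn (hk.inner_const (φ x))
  have h0 : ∫ z in {z : Space n | ε < ‖z‖}, inner ℝ (kernel α z) (φ x) = 0 := by
    simp_rw [real_inner_comm (φ x)]
    rw [integral_inner hk, setIntegral_kernel, inner_zero_right]
  rw [h0, add_zero] at h
  rw [← h]
  refine integral_congr_ae (Eventually.of_forall fun z => ?_)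
  simp only [← inner_kernel]
  rw [← inner_add_right, sub_add_cancel]

lemma fracDivNL_eq {n : ℕ} (α : ℝ) (g : Space n → ℝ) (φ : Space n → Space n) (x : Space n) :
    fracDivNL α g φ x =
      mu n α * ∫ z, (g (x + z) - g x) * inner ℝ (kernel α z) (φ (x + z) - φ x) := by
  rw [fracDivNL, ← integral_add_left_eq_self _ x]
  congr 1
  refine integral_congr_ae (Eventually.of_forall fun z => ?_)
  simp only [add_sub_cancel_left, inner_kernel]
  ring

/-! ### Absolute convergence of ∫ f div^α ψ for Lipschitz fields ψ -/

/-- Since t ≤ t^p + 1 for t ≥ 0, the function |f|^p serves for finite p; for p = ∞ the constant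
alone suffices. All exponents are thus treated together. -/
lemma memLp_exists_norm_le_add {X : Type*} [MeasurableSpace X] {μ : Measure X}
    {p : ℝ≥0∞} (hp : 1 ≤ p) {f : X → ℝ} (hf : MemLp f p μ) :
    ∃ g : X → ℝ, Integrable g μ ∧ (∀ x, 0 ≤ g x) ∧ ∃ C : ℝ, 0 ≤ C ∧ ∀ᵐ x ∂μ, ‖f x‖ ≤ g x + C := by
  by_cases hpt : p = ⊤
  · subst hpt
    refine ⟨0, integrable_zero _ _ _, fun x => le_rfl, (eLpNorm f ⊤ μ).toReal,
      ENNReal.toReal_nonneg, ?_⟩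
    have hfin := hf.2
    filter_upwards [ae_le_eLpNormEssSup (f := f) (μ := μ)] with x hx
    rw [eLpNorm_exponent_top] at hfin ⊢
    simp only [Pi.zero_apply, zero_add]
    rw [← toReal_enorm]
    exact ENNReal.toReal_mono hfin.ne hx
  · have hp0 : p ≠ 0 := (zero_lt_one.trans_le hp).ne'
    refine ⟨fun x => ‖f x‖ ^ p.toReal, hf.integrable_norm_rpow hp0 hpt,
      fun x => by positivity, 1, zero_le_one, Eventually.of_forall fun x => ?_⟩
    rcases le_total ‖f x‖ 1 with h | h
    · exact h.trans (le_add_of_nonneg_left (by positivity))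
    · have h1 : 1 ≤ p.toReal := by
        rw [← ENNReal.toReal_one]; exact ENNReal.toReal_mono hpt hp
      exact (Real.self_le_rpow_of_one_le h h1).trans (le_add_of_nonneg_right zero_le_one)

/-- The characteristic function of the closed ball of radius `R` about the origin. -/
def ballInd {n : ℕ} (R : ℝ) : Space n → ℝ := (Metric.closedBall 0 R).indicator 1

lemma ballInd_nonneg {n : ℕ} (R : ℝ) (y : Space n) : 0 ≤ ballInd R y :=
  indicator_nonneg (fun _ _ => zero_le_one) _

lemma ballInd_le_one {n : ℕ} (R : ℝ) (y : Space n) : ballInd R y ≤ 1 :=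
  indicator_le_self' (fun _ _ => zero_le_one) _

lemma ballInd_of_le {n : ℕ} {R : ℝ} {y : Space n} (hy : ‖y‖ ≤ R) : ballInd R y = 1 :=
  indicator_of_mem (mem_closedBall_zero_iff.2 hy) _

lemma measurable_ballInd {n : ℕ} (R : ℝ) : Measurable (ballInd R : Space n → ℝ) :=
  measurable_one.indicator Metric.isClosed_closedBall.measurableSet

lemma integrable_ballInd {n : ℕ} (R : ℝ) : Integrable (ballInd R : Space n → ℝ) :=
  (integrable_indicator_iff Metric.isClosed_closedBall.measurableSet).2
    (integrableOn_const (measure_closedBall_lt_top (x := (0 : Space n)) (r := R)).ne)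

/-- In |f| ≤ g + C, the integrable part g pairs with k and the indicators are bounded by 2. The
constant part uses integrability of the indicators, the second one after the measure-preserving
shear (y,z) ↦ (y+z,z). -/
lemma integrable_prod_mul_ballInd {n : ℕ} {p : ℝ≥0∞} (hp : 1 ≤ p) {f : Space n → ℝ}
    (hf : MemLp f p) {k : Space n → ℝ} (hk : Integrable k) (R : ℝ) :
    Integrable (fun q : Space n × Space n =>
      f q.1 * (k q.2 * (ballInd R q.1 + ballInd R (q.1 + q.2)))) (volume.prod volume) := by
  obtain ⟨g, hg, hg0, C, hC, hfg⟩ := memLp_exists_norm_le_add hp hf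
  have h1 : Integrable (fun q : Space n × Space n => 2 * (g q.1 * ‖k q.2‖))
    (volume.prod volume) := (hg.mul_prod hk.norm).const_mul 2
  have h2 : Integrable (fun q : Space n × Space n => ballInd R q.1 * ‖k q.2‖)
    (volume.prod volume) := (integrable_ballInd R).mul_prod hk.norm
  have h3 : Integrable (fun q : Space n × Space n => ballInd R (q.1 + q.2) * ‖k q.2‖)
      (volume.prod volume) :=
    (measurePreserving_add_prod volume volume).integrable_comp_of_integrable h2
  have hm : AEStronglyMeasurable (fun q : Space n × Space n =>
      f q.1 * (k q.2 * (ballInd R q.1 + ballInd R (q.1 + q.2)))) (volume.prod volume) := by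
    have hb := measurable_ballInd (n := n) R
    refine hf.1.comp_fst.mul (hk.1.comp_snd.mul ?_)
    exact (Measurable.add (hb.comp measurable_fst)
      (hb.comp (measurable_fst.add measurable_snd))).aestronglyMeasurable
  refine (h1.add ((h2.add h3).const_mul C)).mono' hm ?_
  have hfg' : ∀ᵐ q : Space n × Space n ∂(volume.prod volume), ‖f q.1‖ ≤ g q.1 + C :=
    Measure.quasiMeasurePreserving_fst.ae hfg
  filter_upwards [hfg'] with q hq
  have a0 := ballInd_nonneg R q.1
  have b0 := ballInd_nonneg R (q.1 + q.2)
  have a1 := ballInd_le_one R q.1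
  have b1 := ballInd_le_one R (q.1 + q.2)
  set a := ballInd R q.1
  set b := ballInd R (q.1 + q.2)
  have hn : ‖a + b‖ = a + b := by rw [Real.norm_eq_abs, abs_of_nonneg (add_nonneg a0 b0)]
  simp only [norm_mul, hn, Pi.add_apply]
  have hk0 : 0 ≤ ‖k q.2‖ * (a + b) := by positivity
  calc ‖f q.1‖ * (‖k q.2‖ * (a + b)) ≤ (g q.1 + C) * (‖k q.2‖ * (a + b)) := by gcongr
    _ = g q.1 * ‖k q.2‖ * (a + b) + C * (a * ‖k q.2‖ + b * ‖k q.2‖) := by ring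
    _ ≤ g q.1 * ‖k q.2‖ * 2 + C * (a * ‖k q.2‖ + b * ‖k q.2‖) := by
        have := hg0 q.1
        gcongr
        linarith
    _ = _ := by ring

/-- A quantitative form of being Lipschitz with support in the ball of radius `R`. -/
def DiffBound {n : ℕ} (C R : ℝ) (ψ : Space n → Space n) : Prop :=
  ∀ y z, ‖ψ (y + z) - ψ y‖ ≤ C * (min ‖z‖ 1 * (ballInd R y + ballInd R (y + z)))

/-- The increment vanishes unless y or y+z lies in the ball; otherwise the Lipschitz bound serves
for |z| ≤ 1 and the bound 2M for |z| ≥ 1. The constants depend only on L, M and R, hence are uniform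
along a mollification. -/
lemma diffBound_of_lipschitz {n : ℕ} {ψ : Space n → Space n} {L M R : ℝ} (hL : 0 ≤ L)
    (hLip : ∀ y z, ‖ψ (y + z) - ψ y‖ ≤ L * ‖z‖) (hM : ∀ y, ‖ψ y‖ ≤ M)
    (hR : ∀ y, R < ‖y‖ → ψ y = 0) : DiffBound (L + 2 * M) R ψ := by
  intro y z
  have hM0 : 0 ≤ M := (norm_nonneg _).trans (hM 0)
  by_cases h : R < ‖y‖ ∧ R < ‖y + z‖
  · rw [hR _ h.1, hR _ h.2, sub_zero, norm_zero]
    have := ballInd_nonneg R y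
    have := ballInd_nonneg R (y + z)
    positivity
  have hone : 1 ≤ ballInd R y + ballInd R (y + z) := by
    by_cases hy : R < ‖y‖
    · rw [ballInd_of_le (y := y + z) (not_lt.1 fun h' => h ⟨hy, h'⟩)]
      linarith [ballInd_nonneg R y]
    · rw [ballInd_of_le (y := y) (not_lt.1 hy)]
      linarith [ballInd_nonneg R (y + z)]
  have hmin : ‖ψ (y + z) - ψ y‖ ≤ (L + 2 * M) * min ‖z‖ 1 := by
    rcases le_total ‖z‖ 1 with hz | hz
    · rw [min_eq_left hz]
      refine (hLip y z).trans ?_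
      gcongr
      linarith
    · rw [min_eq_right hz]
      refine (norm_sub_le _ _).trans ?_
      linarith [hM y, hM (y + z)]
  refine hmin.trans ?_
  gcongr
  exact le_mul_of_one_le_right (by positivity) hone

lemma exists_bounds_of_lipschitz {n : ℕ} {ψ : Space n → Space n} (hψ : ∃ K, LipschitzWith K ψ)
    (hc : HasCompactSupport ψ) : ∃ L M R : ℝ, 0 ≤ L ∧
      (∀ y z, ‖ψ (y + z) - ψ y‖ ≤ L * ‖z‖) ∧ (∀ y, ‖ψ y‖ ≤ M) ∧ (∀ y, R < ‖y‖ → ψ y = 0) := by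
  obtain ⟨K, hK⟩ := hψ
  obtain ⟨M, hM⟩ := hc.exists_bound_of_continuous hK.continuous
  obtain ⟨R, hR⟩ := hc.isBounded.subset_closedBall (0 : Space n)
  refine ⟨K, M, R, K.2, fun y z => ?_, hM, fun y hy => ?_⟩
  · simpa using hK.norm_sub_le (y + z) y
  · by_contra h
    have := hR (subset_tsupport ψ h)
    rw [mem_closedBall_zero_iff] at this
    linarith

lemma lipschitzWith_of_contDiff {n : ℕ} {ψ : Space n → Space n} (hψ : ContDiff ℝ (⊤ : ℕ∞) ψ)
    (hc : HasCompactSupport ψ) : ∃ K, LipschitzWith K ψ :=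
  ContDiff.lipschitzWith_of_hasCompactSupport hc hψ (by simp)

namespace DiffBound

variable {n : ℕ} {C R : ℝ} {ψ : Space n → Space n}

lemma norm_inner_kernel_le (h : DiffBound C R ψ) (α : ℝ) (y z : Space n) :
    ‖inner ℝ (kernel α z) (ψ (y + z) - ψ y)‖ ≤
      C * (min ‖z‖ 1 * ‖kernel α z‖ * (ballInd R y + ballInd R (y + z))) := by
  refine (norm_inner_le_norm _ _).trans ?_
  refine (mul_le_mul_of_nonneg_left (h y z) (norm_nonneg _)).trans (le_of_eq ?_)
  ring

lemma measurable_inner_kernel (hψ : Continuous ψ) (α : ℝ) :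
    Measurable (fun q : Space n × Space n =>
      inner ℝ (kernel α q.2) (ψ (q.1 + q.2) - ψ q.1)) := by
  have h1 : Measurable fun q : Space n × Space n => kernel α q.2 :=
    (measurable_kernel α).comp measurable_snd
  exact h1.inner (by fun_prop)

lemma norm_mul_inner_kernel_le (h : DiffBound C R ψ) (α : ℝ) (f : Space n → ℝ)
    (q : Space n × Space n) :
    ‖f q.1 * inner ℝ (kernel α q.2) (ψ (q.1 + q.2) - ψ q.1)‖ ≤ ‖C * (f q.1 *
      (min ‖q.2‖ 1 * ‖kernel α q.2‖ * (ballInd R q.1 + ballInd R (q.1 + q.2))))‖ := by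
  rw [norm_mul]
  refine (mul_le_mul_of_nonneg_left (h.norm_inner_kernel_le α q.1 q.2) (norm_nonneg _)).trans ?_
  have := ballInd_nonneg R q.1
  have := ballInd_nonneg R (q.1 + q.2)
  have h0 : 0 ≤ min ‖q.2‖ 1 * ‖kernel α q.2‖ * (ballInd R q.1 + ballInd R (q.1 + q.2)) := by
    positivity
  rw [norm_mul, norm_mul, Real.norm_of_nonneg h0, mul_left_comm]
  gcongr
  exact Real.le_norm_self _

lemma integrable_prod (h : DiffBound C R ψ) (hψ : Continuous ψ) (hn : 1 ≤ n) {α : ℝ}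
    (hα0 : 0 < α) (hα1 : α < 1) {p : ℝ≥0∞} (hp : 1 ≤ p) {f : Space n → ℝ} (hf : MemLp f p) :
    Integrable (fun q : Space n × Space n =>
      f q.1 * inner ℝ (kernel α q.2) (ψ (q.1 + q.2) - ψ q.1)) (volume.prod volume) :=
  ((integrable_prod_mul_ballInd hp hf (integrable_min_norm_kernel hn hα0 hα1) R).const_mul
    C).norm.mono' (hf.1.comp_fst.mul (measurable_inner_kernel hψ α).aestronglyMeasurable)
      (Eventually.of_forall (h.norm_mul_inner_kernel_le α f))

lemma integrable_inner_kernel (h : DiffBound C R ψ) (hψ : Continuous ψ) (hn : 1 ≤ n) {α : ℝ}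
    (hα0 : 0 < α) (hα1 : α < 1) (y : Space n) :
    Integrable fun z => inner ℝ (kernel α z) (ψ (y + z) - ψ y) := by
  refine (((integrable_min_norm_kernel hn hα0 hα1).mul_const 2).const_mul |C|).mono'
    ((measurable_inner_kernel hψ α).comp measurable_prodMk_left).aestronglyMeasurable
    (Eventually.of_forall fun z => (h.norm_inner_kernel_le α y z).trans ?_)
  have := ballInd_nonneg R y
  have := ballInd_nonneg R (y + z)
  have := ballInd_le_one R y
  have := ballInd_le_one R (y + z)
  gcongr
  · exact le_abs_self C
  · linarith

lemma fracDiv_eq (h : DiffBound C R ψ) (hψ : Continuous ψ) (hn : 1 ≤ n) {α : ℝ}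
    (hα0 : 0 < α) (hα1 : α < 1) (y : Space n) :
    fracDiv α ψ y = mu n α * ∫ z, inner ℝ (kernel α z) (ψ (y + z) - ψ y) :=
  FracBV.fracDiv_eq hn hα0 hα1 (h.integrable_inner_kernel hψ hn hα0 hα1 y)

lemma mul_fracDiv_eq (h : DiffBound C R ψ) (hψ : Continuous ψ) (hn : 1 ≤ n) {α : ℝ}
    (hα0 : 0 < α) (hα1 : α < 1) (f : Space n → ℝ) :
    (fun y => f y * fracDiv α ψ y) = fun y =>
      mu n α * ∫ z, f y * inner ℝ (kernel α z) (ψ (y + z) - ψ y) := by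
  funext y
  rw [h.fracDiv_eq hψ hn hα0 hα1, integral_const_mul]
  ring

lemma integrable_mul_fracDiv (h : DiffBound C R ψ) (hψ : Continuous ψ) (hn : 1 ≤ n) {α : ℝ}
    (hα0 : 0 < α) (hα1 : α < 1) {p : ℝ≥0∞} (hp : 1 ≤ p) {f : Space n → ℝ} (hf : MemLp f p) :
    Integrable fun y => f y * fracDiv α ψ y := by
  rw [h.mul_fracDiv_eq hψ hn hα0 hα1]
  exact (h.integrable_prod hψ hn hα0 hα1 hp hf).integral_prod_left.const_mul _

lemma integral_mul_fracDiv (h : DiffBound C R ψ) (hψ : Continuous ψ) (hn : 1 ≤ n) {α : ℝ}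
    (hα0 : 0 < α) (hα1 : α < 1) {p : ℝ≥0∞} (hp : 1 ≤ p) {f : Space n → ℝ} (hf : MemLp f p) :
    ∫ y, f y * fracDiv α ψ y = mu n α * ∫ q : Space n × Space n,
      f q.1 * inner ℝ (kernel α q.2) (ψ (q.1 + q.2) - ψ q.1) ∂(volume.prod volume) := by
  rw [h.mul_fracDiv_eq hψ hn hα0 hα1, integral_const_mul,
    integral_prod _ (h.integrable_prod hψ hn hα0 hα1 hp hf)]

end DiffBound

/-! ### Vector measures as densities against their variation -/

lemma isFiniteMeasure_variation_withDensityᵥ {X : Type*} [MeasurableSpace X] {μ : Measure X} {n : ℕ}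
    {h : X → Space n} (hh : Integrable h μ) :
    IsFiniteMeasure (μ.withDensityᵥ h).variation := by
  rw [Measure.variation_withDensityᵥ hh]
  exact isFiniteMeasure_withDensity hh.2.ne

/-- The integral against a vector measure with density is the integral of the pairing with
the density. -/
lemma integral_withDensityᵥ_inner {X : Type*} [MeasurableSpace X] {μ : Measure X} {n : ℕ}
    {h : X → Space n} (hh : Integrable h μ) {ψ : X → Space n} (hψ : StronglyMeasurable ψ)
    {M : ℝ} (hM : ∀ x, ‖ψ x‖ ≤ M) :
    ∫ᵛ x, ψ x ∂[innerSL ℝ; μ.withDensityᵥ h] = ∫ x, inner ℝ (ψ x) (h x) ∂μ := by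
  have hfin := isFiniteMeasure_variation_withDensityᵥ hh
  -- Both sides are additive in the field and agree on indicators, hence on simple functions;
  -- bounded simple approximations and dominated convergence on each side give the general case.
  have hsimple : ∀ g : SimpleFunc X (Space n),
      (∫ᵛ x, g x ∂[innerSL ℝ; μ.withDensityᵥ h] = ∫ x, inner ℝ (g x) (h x) ∂μ) ∧
        Integrable (fun x => inner ℝ (g x) (h x)) μ := by
    intro g
    induction g using SimpleFunc.induction with
    | const c hs =>
      rename_i s
      have e1 : ((SimpleFunc.piecewise s hs (SimpleFunc.const X c) (SimpleFunc.const X 0) :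
          SimpleFunc X (Space n)) : X → Space n) = s.indicator (fun _ => c) := by
        ext1 x; by_cases hx : x ∈ s <;> simp [hx]
      have e2 : ∀ x, inner ℝ (s.indicator (fun _ => c) x) (h x)
          = s.indicator (fun x => inner ℝ c (h x)) x := by
        intro x; by_cases hx : x ∈ s <;> simp [hx]
      have hfin' : IsFiniteMeasure ((μ.withDensityᵥ h).restrict s).variation := by
        rw [VectorMeasure.variation_restrict hs]; infer_instance
      simp_rw [e1, e2]
      refine ⟨?_, (hh.const_inner c).indicator hs⟩
      rw [VectorMeasure.integral_indicator hs, VectorMeasure.integral_const,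
        MeasureTheory.integral_indicator hs, integral_inner hh.integrableOn,
        VectorMeasure.restrict_apply _ hs MeasurableSet.univ, univ_inter,
        withDensityᵥ_apply hh hs]
      rfl
    | add hd hf hg =>
      rename_i f g
      have e1 : ∀ x, inner ℝ ((f + g) x) (h x) = inner ℝ (f x) (h x) + inner ℝ (g x) (h x) := by
        intro x; rw [SimpleFunc.add_apply, inner_add_left]
      simp_rw [e1]
      refine ⟨?_, hf.2.add hg.2⟩
      rw [integral_add hf.2 hg.2, ← hf.1, ← hg.1, ← VectorMeasure.integral_fun_add]
      · rfl
      · exact f.integrable_of_isFiniteMeasure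
      · exact g.integrable_of_isFiniteMeasure
  have hM0 : ∀ x : X, 0 ≤ M := fun x => (norm_nonneg _).trans (hM x)
  have l1 : Tendsto (fun k => ∫ᵛ x, hψ.approxBounded M k x ∂[innerSL ℝ; μ.withDensityᵥ h]) atTop
      (𝓝 (∫ᵛ x, ψ x ∂[innerSL ℝ; μ.withDensityᵥ h])) := by
    refine VectorMeasure.tendsto_integral_of_dominated_convergence (fun _ => M)
      (fun k => (SimpleFunc.stronglyMeasurable _).aestronglyMeasurable) (integrable_const _)
      (fun k => Eventually.of_forall fun x => hψ.norm_approxBounded_le (hM0 x) k x)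
      (Eventually.of_forall fun x => hψ.tendsto_approxBounded_of_norm_le (hM x))
  have l2 : Tendsto (fun k => ∫ x, inner ℝ (hψ.approxBounded M k x) (h x) ∂μ) atTop
      (𝓝 (∫ x, inner ℝ (ψ x) (h x) ∂μ)) := by
    refine tendsto_integral_of_dominated_convergence (fun x => M * ‖h x‖)
      (fun k => (hsimple _).2.1) (hh.norm.const_mul M)
      (fun k => Eventually.of_forall fun x => (norm_inner_le_norm _ _).trans ?_)
      (Eventually.of_forall fun x =>
        (hψ.tendsto_approxBounded_of_norm_le (hM x)).inner tendsto_const_nhds)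
    gcongr
    exact hψ.norm_approxBounded_le (hM0 x) k x
  refine tendsto_nhds_unique l1 ?_
  simp_rw [fun k => (hsimple (hψ.approxBounded M k)).1]
  exact l2

/-- Polar decomposition of a vector measure of finite variation. -/
lemma exists_withDensityᵥ_variation {X : Type*} [MeasurableSpace X] {n : ℕ}
    (D : VectorMeasure X (Space n)) [IsFiniteMeasure D.variation] :
    ∃ h : X → Space n, Integrable h D.variation ∧ D = D.variation.withDensityᵥ h := by
  let coord : Fin n → Space n →L[ℝ] ℝ := fun i => EuclideanSpace.proj i
  let s : Fin n → SignedMeasure X := fun i =>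
    D.mapRange (coord i).toLinearMap.toAddMonoidHom (coord i).continuous
  have hs : ∀ i A, s i A = (D A) i := fun i A => rfl
  -- A set of zero variation is null for D, hence for each coordinate, so Radon–Nikodym applies
  -- coordinatewise.
  have hac : ∀ i, s i ≪ᵥ D.variation.toENNRealVectorMeasure := by
    intro i
    refine VectorMeasure.AbsolutelyContinuous.mk fun A hA h0 => ?_
    rw [Measure.toENNRealVectorMeasure_apply_measurable hA] at h0
    have h1 := (VectorMeasure.variation_apply_eq_zero hA).1 h0 A subset_rfl hA
    rw [hs, h1]
    rfl
  let h : X → Space n := fun x => WithLp.toLp 2 fun i => (s i).rnDeriv D.variation x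
  have hh : Integrable h D.variation := by
    rw [integrable_piLp_iff]
    exact fun i => SignedMeasure.integrable_rnDeriv _ _
  refine ⟨h, hh, ?_⟩
  ext A hA i
  rw [withDensityᵥ_apply hh hA]
  have e := (s i).withDensityᵥ_rnDeriv_eq D.variation (hac i)
  have e2 : s i A = ∫ x in A, (s i).rnDeriv D.variation x ∂D.variation := by
    conv_lhs => rw [← e]
    rw [withDensityᵥ_apply (SignedMeasure.integrable_rnDeriv _ _) hA]
  rw [← hs, e2]
  exact ((coord i).integral_comp_comm hh.integrableOn)

/-- This turns pairings with D into integrals against a positive measure, where the scalar Fubini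
theorem is available for averaging in the radius. -/
lemma exists_integral_eq_integral_inner {X : Type*} [MeasurableSpace X] {n : ℕ}
    (D : VectorMeasure X (Space n)) [IsFiniteMeasure D.variation] :
    ∃ h : X → Space n, Integrable h D.variation ∧ ∀ (ψ : X → Space n) (M : ℝ),
      StronglyMeasurable ψ → (∀ x, ‖ψ x‖ ≤ M) →
        ∫ᵛ x, ψ x ∂[innerSL ℝ; D] = ∫ x, inner ℝ (ψ x) (h x) ∂D.variation := by
  obtain ⟨h, hh, hD⟩ := exists_withDensityᵥ_variation D
  refine ⟨h, hh, fun ψ M hψ hM => ?_⟩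
  conv_lhs => rw [hD]
  exact integral_withDensityᵥ_inner hh hψ hM

/-! ### Riesz representation of bounded signed functionals -/

open CompactlySupported NNReal CompactlySupportedContinuousMap in
/-- The positive part of a linear functional on compactly supported continuous functions. -/
def posPartFun {X : Type*} [TopologicalSpace X] (ℓ : C_c(X, ℝ) →ₗ[ℝ] ℝ) (g : C_c(X, ℝ≥0)) : ℝ :=
  sSup {t | ∃ h : C_c(X, ℝ≥0), h ≤ g ∧ ℓ h.toReal = t}

section RieszFunctional

open CompactlySupported NNReal CompactlySupportedContinuousMap

variable {X : Type*} [TopologicalSpace X] {ℓ : C_c(X, ℝ) →ₗ[ℝ] ℝ} {C : ℝ}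

/-- The functional `ℓ` has norm at most `C` for the supremum norm. -/
def SupBounded (ℓ : C_c(X, ℝ) →ₗ[ℝ] ℝ) (C : ℝ) : Prop :=
  ∀ (g : C_c(X, ℝ)) (M : ℝ), 0 ≤ M → (∀ x, |g x| ≤ M) → |ℓ g| ≤ C * M

lemma SupBounded.neg (h : SupBounded ℓ C) : SupBounded (-ℓ) C := fun g M hM hg => by
  simpa using h g M hM hg

lemma SupBounded.apply_le (h : SupBounded ℓ C) {g k : C_c(X, ℝ≥0)} {M : ℝ} (hM : 0 ≤ M)
    (hg : ∀ x, (g x : ℝ) ≤ M) (hk : k ≤ g) : ℓ k.toReal ≤ C * M :=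
  (le_abs_self _).trans (h _ M hM fun x => by
    rw [toReal_apply, abs_of_nonneg (NNReal.coe_nonneg _)]
    exact (NNReal.coe_le_coe.2 (hk x)).trans (hg x))

lemma exists_apply_le (g : C_c(X, ℝ≥0)) : ∃ M : ℝ, 0 ≤ M ∧ ∀ x, (g x : ℝ) ≤ M := by
  obtain ⟨M, hM⟩ := g.toReal.hasCompactSupport.exists_bound_of_continuous g.toReal.continuous
  refine ⟨|M|, abs_nonneg _, fun x => ?_⟩
  have := (hM x).trans (le_abs_self M)
  rw [toReal_apply] at this
  exact (Real.le_norm_self _).trans this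

lemma SupBounded.le_posPartFun (h : SupBounded ℓ C) {g k : C_c(X, ℝ≥0)} (hk : k ≤ g) :
    ℓ k.toReal ≤ posPartFun ℓ g := by
  obtain ⟨M, hM, hg⟩ := exists_apply_le g
  refine le_csSup ⟨C * M, ?_⟩ ⟨k, hk, rfl⟩
  rintro t ⟨k', hk', rfl⟩
  exact h.apply_le hM hg hk'

lemma posPartFun_le {g : C_c(X, ℝ≥0)} {a : ℝ} (ha : ∀ k ≤ g, ℓ k.toReal ≤ a) :
    posPartFun ℓ g ≤ a := by
  refine csSup_le ⟨_, g, le_rfl, rfl⟩ ?_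
  rintro t ⟨k, hk, rfl⟩
  exact ha k hk

lemma SupBounded.posPartFun_nonneg (h : SupBounded ℓ C) (g : C_c(X, ℝ≥0)) :
    0 ≤ posPartFun ℓ g := by
  have h0 : ((0 : C_c(X, ℝ≥0)).toReal) = 0 := by ext; simp
  have := h.le_posPartFun (k := 0) (g := g) (fun x => by simp)
  rwa [h0, map_zero] at this

/-- Riesz decomposition: any 0 ≤ k ≤ g₁ + g₂ splits into k ⊓ g₁ and a remainder at most g₂.
Conversely, competitors for g₁ and g₂ add up to one for the sum. -/
lemma SupBounded.posPartFun_add (h : SupBounded ℓ C) (g₁ g₂ : C_c(X, ℝ≥0)) :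
    posPartFun ℓ (g₁ + g₂) = posPartFun ℓ g₁ + posPartFun ℓ g₂ := by
  apply le_antisymm
  · refine posPartFun_le fun k hk => ?_
    have hle : k ⊓ g₁ ≤ k := fun x => by simp
    obtain ⟨k₂, hk₂⟩ := CompactlySupportedContinuousMap.exists_add_of_le hle
    have h1 : k ⊓ g₁ ≤ g₁ := fun x => by simp
    have h2 : k₂ ≤ g₂ := by
      intro x
      have e := congr($hk₂ x)
      have hkx := hk x
      simp only [coe_add, Pi.add_apply, inf_apply] at e hkx
      rcases le_total (k x) (g₁ x) with hx | hx
      · rw [inf_eq_left.2 hx] at e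
        have : k₂ x = 0 := by simpa using e
        rw [this]; exact zero_le
      · rw [inf_eq_right.2 hx] at e
        rw [← e] at hkx
        exact le_of_add_le_add_left hkx
    rw [← hk₂, toReal_add, map_add]
    exact add_le_add (h.le_posPartFun h1) (h.le_posPartFun h2)
  · rw [← le_sub_iff_add_le]
    refine posPartFun_le fun k₁ hk₁ => ?_
    rw [le_sub_comm]
    refine posPartFun_le fun k₂ hk₂ => ?_
    rw [le_sub_iff_add_le, add_comm, ← map_add, ← toReal_add]
    exact h.le_posPartFun (add_le_add hk₁ hk₂)

lemma SupBounded.mul_posPartFun_le (h : SupBounded ℓ C) {c : ℝ≥0} (hc : 0 < c)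
    (g : C_c(X, ℝ≥0)) : c * posPartFun ℓ g ≤ posPartFun ℓ (c • g) := by
  have hc' : (0 : ℝ) < c := hc
  rw [← le_div_iff₀' hc']
  refine posPartFun_le fun k hk => ?_
  rw [le_div_iff₀' hc', ← smul_eq_mul, ← map_smul]
  have e : (c : ℝ) • k.toReal = (c • k).toReal := by
    ext; simp [NNReal.smul_def]
  rw [e]
  exact h.le_posPartFun fun x => by simpa using mul_le_mul_right (hk x) c

lemma SupBounded.posPartFun_smul (h : SupBounded ℓ C) (c : ℝ≥0) (g : C_c(X, ℝ≥0)) :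
    posPartFun ℓ (c • g) = c * posPartFun ℓ g := by
  rcases eq_or_ne c 0 with rfl | hc
  -- For c = 0 there is no rescaling; additivity at 0 forces the value 0.
  · have := h.posPartFun_add 0 0
    simp only [add_zero] at this
    simp only [zero_smul, NNReal.coe_zero, zero_mul]
    linarith
  have hc0 : 0 < c := pos_iff_ne_zero.2 hc
  refine le_antisymm ?_ (h.mul_posPartFun_le hc0 g)
  have h2 := h.mul_posPartFun_le (inv_pos.2 hc0) (c • g)
  rw [smul_smul, inv_mul_cancel₀ hc, one_smul, NNReal.coe_inv] at h2
  rwa [inv_mul_le_iff₀ (NNReal.coe_pos.2 hc0)] at h2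

/-- The positive part of a bounded functional as a positive linear functional. -/
def SupBounded.posPartLinear (h : SupBounded ℓ C) : C_c(X, ℝ≥0) →ₗ[ℝ≥0] ℝ≥0 where
  toFun g := ⟨posPartFun ℓ g, h.posPartFun_nonneg g⟩
  map_add' g₁ g₂ := NNReal.eq (h.posPartFun_add g₁ g₂)
  map_smul' c g := NNReal.eq (h.posPartFun_smul c g)

/-- For k ≤ g one has ℓ(k) = ℓ(g) + (−ℓ)(g − k), and g − k is a competitor for the positive part of
−ℓ. Applied to ℓ and to −ℓ, this yields the Jordan decomposition. -/
lemma SupBounded.posPartFun_le_add (h : SupBounded ℓ C) (g : C_c(X, ℝ≥0)) :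
    posPartFun ℓ g ≤ ℓ g.toReal + posPartFun (-ℓ) g := by
  refine posPartFun_le fun k hk => ?_
  obtain ⟨k', hk'⟩ := CompactlySupportedContinuousMap.exists_add_of_le hk
  have hle : k' ≤ g := fun x => by
    rw [← hk']; simp
  have := h.neg.le_posPartFun hle
  rw [← hk', toReal_add, map_add]
  rw [← hk'] at this
  simp only [LinearMap.neg_apply] at this
  linarith

lemma SupBounded.posPartFun_sub (h : SupBounded ℓ C) (g : C_c(X, ℝ≥0)) :
    posPartFun ℓ g - posPartFun (-ℓ) g = ℓ g.toReal := by
  have h1 := h.posPartFun_le_add g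
  have h2 := h.neg.posPartFun_le_add g
  rw [neg_neg, LinearMap.neg_apply] at h2
  linarith

lemma integrable_coe [MeasurableSpace X] [OpensMeasurableSpace X] (k : C_c(X, ℝ≥0))
    (m : Measure X) [IsFiniteMeasureOnCompacts m] : Integrable (fun x => (k x : ℝ)) m := by
  have hk : (fun x => (k x : ℝ)) = k.toReal := by ext; simp
  rw [hk]
  exact k.toReal.continuous.integrable_of_hasCompactSupport k.toReal.hasCompactSupport

variable [T2Space X] [LocallyCompactSpace X] [MeasurableSpace X] [BorelSpace X]

lemma SupBounded.isFiniteMeasure (h : SupBounded ℓ C) :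
    IsFiniteMeasure (NNRealRMK.rieszMeasure h.posPartLinear) := by
  refine ⟨lt_of_le_of_lt ?_ (ENNReal.ofReal_lt_top (r := C * 1))⟩
  -- By inner regularity it is enough to bound compact sets; a cutoff equal to 1 on K with values in
  -- [0,1] bounds the mass of K by C.
  rw [isOpen_univ.measure_eq_iSup_isCompact]
  refine iSup₂_le fun K _ => iSup_le fun hK => ?_
  obtain ⟨g, hg1, -, hgc, hg01⟩ := exists_continuous_one_zero_of_isCompact hK
    isClosed_empty (disjoint_empty K)
  let g' : C_c(X, ℝ) := ⟨g, hgc⟩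
  have hint := NNRealRMK.integral_rieszMeasure h.posPartLinear g'.nnrealPart
  have hle : (h.posPartLinear g'.nnrealPart : ℝ) ≤ C * 1 := by
    refine posPartFun_le fun k hk => h.apply_le zero_le_one (fun x => ?_) hk
    have := (hg01 x).2
    simpa [g'] using this
  rw [← hint] at hle
  have hgi := integrable_coe g'.nnrealPart (NNRealRMK.rieszMeasure h.posPartLinear)
  refine le_trans ?_ (ENNReal.ofReal_le_ofReal hle)
  rw [ofReal_integral_eq_lintegral_ofReal hgi (Eventually.of_forall fun x => NNReal.coe_nonneg _)]
  rw [← lintegral_indicator_one hK.measurableSet]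
  refine lintegral_mono fun x => ?_
  by_cases hx : x ∈ K
  · have : g x = 1 := hg1 hx
    simp [hx, g', this]
  · simp [hx]

/-- **Riesz representation** of bounded functionals: such a functional is the difference of the
integrals against two finite measures. -/
theorem SupBounded.exists_measure (h : SupBounded ℓ C) :
    ∃ μ ν : Measure X, IsFiniteMeasure μ ∧ IsFiniteMeasure ν ∧
      ∀ g : C_c(X, ℝ), ℓ g = ∫ x, g x ∂μ - ∫ x, g x ∂ν := by
  have hμ := h.isFiniteMeasure
  have hν := h.neg.isFiniteMeasure
  refine ⟨_, _, hμ, hν, fun g => ?_⟩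
  set μ := NNRealRMK.rieszMeasure h.posPartLinear
  set ν := NNRealRMK.rieszMeasure h.neg.posPartLinear
  have hpos : ∀ k : C_c(X, ℝ≥0), ℓ k.toReal = ∫ x, (k x : ℝ) ∂μ - ∫ x, (k x : ℝ) ∂ν := by
    intro k
    rw [NNRealRMK.integral_rieszMeasure, NNRealRMK.integral_rieszMeasure]
    exact (h.posPartFun_sub k).symm
  have hg : ∀ x, g x = (g.nnrealPart x : ℝ) - ((-g).nnrealPart x : ℝ) := by
    intro x
    simp
  conv_lhs => rw [← nnrealPart_sub_nnrealPart_neg g]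
  rw [map_sub, hpos, hpos]
  simp_rw [hg]
  rw [integral_sub (integrable_coe _ _) (integrable_coe _ _), integral_sub (integrable_coe _ _) (integrable_coe _ _)]
  ring

end RieszFunctional

/-! ### Existence of the fractional variation measure -/

lemma exists_diffBound {n : ℕ} {ψ : Space n → Space n} (hψ : ∃ K, LipschitzWith K ψ)
    (hc : HasCompactSupport ψ) : ∃ C R, DiffBound C R ψ := by
  obtain ⟨L, M, R, hL, hLip, hM, hR⟩ := exists_bounds_of_lipschitz hψ hc
  exact ⟨_, R, diffBound_of_lipschitz hL hLip hM hR⟩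

section Linearity

variable {n : ℕ} {α : ℝ} {p : ℝ≥0∞} {f : Space n → ℝ} {φ ψ : Space n → Space n}

lemma integral_mul_fracDiv_smul (α : ℝ) (f : Space n → ℝ) (φ : Space n → Space n)
    (hn : 1 ≤ n) (hα0 : 0 < α) (hα1 : α < 1) (hφ : ∃ K, LipschitzWith K φ)
    (hφc : HasCompactSupport φ) (c : ℝ) (hcφ : ∃ K, LipschitzWith K (c • φ))
    (hcφc : HasCompactSupport (c • φ)) :
    ∫ y, f y * fracDiv α (c • φ) y = c * ∫ y, f y * fracDiv α φ y := by
  obtain ⟨C, R, hb⟩ := exists_diffBound hφ hφc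
  obtain ⟨C', R', hb'⟩ := exists_diffBound hcφ hcφc
  rw [← integral_const_mul]
  refine integral_congr_ae (Eventually.of_forall fun y => ?_)
  simp only
  rw [hb.fracDiv_eq hφ.choose_spec.continuous hn hα0 hα1,
    hb'.fracDiv_eq hcφ.choose_spec.continuous hn hα0 hα1]
  simp only [Pi.smul_apply, ← smul_sub, real_inner_smul_right, integral_const_mul]
  ring

lemma integral_mul_fracDiv_add (hn : 1 ≤ n) (hα0 : 0 < α) (hα1 : α < 1) (hp : 1 ≤ p)
    (hf : MemLp f p) (hφ : ∃ K, LipschitzWith K φ) (hφc : HasCompactSupport φ)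
    (hψ : ∃ K, LipschitzWith K ψ) (hψc : HasCompactSupport ψ)
    (hs : ∃ K, LipschitzWith K (φ + ψ)) (hsc : HasCompactSupport (φ + ψ)) :
    ∫ y, f y * fracDiv α (φ + ψ) y =
      (∫ y, f y * fracDiv α φ y) + ∫ y, f y * fracDiv α ψ y := by
  obtain ⟨C, R, hb⟩ := exists_diffBound hφ hφc
  obtain ⟨C', R', hb'⟩ := exists_diffBound hψ hψc
  obtain ⟨C'', R'', hb''⟩ := exists_diffBound hs hsc
  have c1 := hφ.choose_spec.continuous
  have c2 := hψ.choose_spec.continuous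
  have c3 := hs.choose_spec.continuous
  rw [← integral_add (hb.integrable_mul_fracDiv c1 hn hα0 hα1 hp hf)
    (hb'.integrable_mul_fracDiv c2 hn hα0 hα1 hp hf)]
  refine integral_congr_ae (Eventually.of_forall fun y => ?_)
  simp only
  rw [hb.fracDiv_eq c1 hn hα0 hα1, hb'.fracDiv_eq c2 hn hα0 hα1, hb''.fracDiv_eq c3 hn hα0 hα1,
    ← mul_add, ← mul_add, ← integral_add (hb.integrable_inner_kernel c1 hn hα0 hα1 y)
      (hb'.integrable_inner_kernel c2 hn hα0 hα1 y)]
  simp only [Pi.add_apply, ← inner_add_right, add_sub_add_comm]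

end Linearity

open scoped BoundedContinuousFunction

/-- The space of smooth compactly supported vector fields, inside the bounded continuous ones. -/
def testFields (n : ℕ) : Submodule ℝ (Space n →ᵇ Space n) where
  carrier := {φ | ContDiff ℝ (⊤ : ℕ∞) φ ∧ HasCompactSupport φ}
  add_mem' h₁ h₂ := ⟨h₁.1.add h₂.1, h₁.2.add h₂.2⟩
  zero_mem' := ⟨contDiff_const, HasCompactSupport.zero⟩
  smul_mem' _ _ h := ⟨contDiff_const.smul h.1, h.2.smul_left⟩

/-- The functional `φ ↦ ∫ f div^α φ` on test fields. -/
def fracFunctional {n : ℕ} (hn : 1 ≤ n) {α : ℝ} (hα0 : 0 < α) (hα1 : α < 1) {p : ℝ≥0∞}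
    (hp : 1 ≤ p) {f : Space n → ℝ} (hf : MemLp f p) : testFields n →ₗ[ℝ] ℝ where
  toFun φ := ∫ y, f y * fracDiv α φ.1 y
  map_add' φ ψ := by
    have h := (φ + ψ).2
    exact integral_mul_fracDiv_add hn hα0 hα1 hp hf (lipschitzWith_of_contDiff φ.2.1 φ.2.2) φ.2.2
      (lipschitzWith_of_contDiff ψ.2.1 ψ.2.2) ψ.2.2 (lipschitzWith_of_contDiff h.1 h.2) h.2
  map_smul' c φ := by
    have h := (c • φ).2
    exact integral_mul_fracDiv_smul α f _ hn hα0 hα1 (lipschitzWith_of_contDiff φ.2.1 φ.2.2) φ.2.2 c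
      (lipschitzWith_of_contDiff h.1 h.2) h.2

lemma fracFunctional_le {n : ℕ} (hn : 1 ≤ n) {α : ℝ} (hα0 : 0 < α) (hα1 : α < 1) {p : ℝ≥0∞}
    (hp : 1 ≤ p) {f : Space n → ℝ} (hf : MemLp f p) (hV : fracVariation α f < ⊤)
    (φ : testFields n) {M : ℝ} (hM : 0 ≤ M) (hφ : ∀ x, ‖φ.1 x‖ ≤ M) :
    fracFunctional hn hα0 hα1 hp hf φ ≤ (fracVariation α f).toReal * M := by
  rcases hM.eq_or_lt with rfl | hpos
  -- The rescaling by M⁻¹ to a competitor of norm at most 1 fails for M = 0, where the field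
  -- vanishes.
  · have h0 : φ = 0 := Subtype.ext (BoundedContinuousFunction.ext fun x =>
      norm_le_zero_iff.1 (hφ x))
    rw [h0, (fracFunctional hn hα0 hα1 hp hf).map_zero, mul_zero]
  have hle : ENNReal.ofReal (fracFunctional hn hα0 hα1 hp hf (M⁻¹ • φ)) ≤ fracVariation α f := by
    refine le_iSup_of_le (M⁻¹ • φ).1 (le_iSup_of_le (M⁻¹ • φ).2.1
      (le_iSup_of_le (M⁻¹ • φ).2.2 (le_iSup_of_le (fun x => ?_) le_rfl)))
    change ‖M⁻¹ • φ.1 x‖ ≤ 1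
    rw [norm_smul, Real.norm_of_nonneg (inv_nonneg.2 hM), inv_mul_le_iff₀ hpos, mul_one]
    exact hφ x
  have h1 := (ENNReal.ofReal_le_iff_le_toReal hV.ne).1 hle
  rwa [(fracFunctional hn hα0 hα1 hp hf).map_smul, smul_eq_mul, inv_mul_le_iff₀ hpos,
    mul_comm] at h1

lemma abs_fracFunctional_le {n : ℕ} (hn : 1 ≤ n) {α : ℝ} (hα0 : 0 < α) (hα1 : α < 1) {p : ℝ≥0∞}
    (hp : 1 ≤ p) {f : Space n → ℝ} (hf : MemLp f p) (hV : fracVariation α f < ⊤)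
    (φ : testFields n) :
    ‖fracFunctional hn hα0 hα1 hp hf φ‖ ≤ (fracVariation α f).toReal * ‖φ‖ := by
  have hM : ∀ x, ‖φ.1 x‖ ≤ ‖φ‖ := fun x => φ.1.norm_coe_le_norm x
  have h0 : 0 ≤ ‖φ‖ := (norm_nonneg _).trans (hM 0)
  rw [Real.norm_eq_abs, abs_le']
  refine ⟨fracFunctional_le hn hα0 hα1 hp hf hV φ h0 hM, ?_⟩
  have h := fracFunctional_le hn hα0 hα1 hp hf hV ((-1 : ℝ) • φ) h0 fun x => by
    change ‖(-1 : ℝ) • φ.1 x‖ ≤ ‖φ‖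
    rw [neg_one_smul, norm_neg]
    exact hM x
  rwa [(fracFunctional hn hα0 hα1 hp hf).map_smul, neg_one_smul] at h

/-- Hahn–Banach reaches all bounded continuous fields at once, so the functional can be tested on g
e_i with g merely continuous, without a density argument. -/
lemma exists_functional {n : ℕ} (hn : 1 ≤ n) {α : ℝ} (hα0 : 0 < α) (hα1 : α < 1) {p : ℝ≥0∞}
    (hp : 1 ≤ p) {f : Space n → ℝ} (hf : MemBV α p f) :
    ∃ L : (Space n →ᵇ Space n) →L[ℝ] ℝ, ∀ φ : testFields n,
      L φ.1 = ∫ y, f y * fracDiv α φ.1 y := by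
  obtain ⟨L, hL, -⟩ := exists_extension_norm_eq (testFields n)
    ((fracFunctional hn hα0 hα1 hp hf.1).mkContinuous (fracVariation α f).toReal
      (abs_fracFunctional_le hn hα0 hα1 hp hf.1 hf.2))
  exact ⟨L, fun φ => hL φ⟩

/-- The standard basis vector `e_i`. -/
def basisVec {n : ℕ} (i : Fin n) : Space n := EuclideanSpace.single i 1

lemma exists_measure_coord {n : ℕ} (L : (Space n →ᵇ Space n) →L[ℝ] ℝ) (i : Fin n) :
    ∃ μ ν : Measure (Space n), IsFiniteMeasure μ ∧ IsFiniteMeasure ν ∧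
      ∀ (g : Space n → ℝ), Continuous g → HasCompactSupport g →
        ∀ G : Space n →ᵇ Space n, (∀ x, G x = g x • basisVec i) →
          L G = ∫ x, g x ∂μ - ∫ x, g x ∂ν := by
  let A := L.comp ((ContinuousLinearMap.toSpanSingleton ℝ (basisVec i)).compLeftContinuousBounded
    (Space n))
  let ℓ : CompactlySupportedContinuousMap (Space n) ℝ →ₗ[ℝ] ℝ :=
    { toFun := fun g => A g.toBoundedContinuousFunction
      map_add' := fun g h => by
        rw [← map_add]; congr 1
      map_smul' := fun c g => by
        rw [RingHom.id_apply, ← map_smul]; congr 1 }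
  have hℓ : SupBounded ℓ ‖A‖ := fun g M hM hg => by
    refine (A.le_opNorm _).trans ?_
    gcongr
    exact (BoundedContinuousFunction.norm_le hM).2 hg
  obtain ⟨μ, ν, hμ, hν, h⟩ := hℓ.exists_measure
  refine ⟨μ, ν, hμ, hν, fun g hg hgc G hG => ?_⟩
  refine Eq.trans ?_ (h ⟨⟨g, hg⟩, hgc⟩)
  change L G = L _
  congr 1
  ext1 x
  exact hG x

theorem exists_isFracDerivative {n : ℕ} (hn : 1 ≤ n) {α : ℝ} (hα0 : 0 < α) (hα1 : α < 1)
    {p : ℝ≥0∞} (hp : 1 ≤ p) {f : Space n → ℝ} (hf : MemBV α p f) :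
    ∃ D, IsFracDerivative α f D := by
  obtain ⟨L, hL⟩ := exists_functional hn hα0 hα1 hp hf
  choose μ ν hμ hν hrep using fun i => exists_measure_coord L i
  -- If μ_i − ν_i represents the i-th coordinate functional, the measure sought is Σ (ν_i − μ_i)
  -- e_i: the order is reversed by the minus sign in the integration by parts formula.
  let P : Fin n → VectorMeasure (Space n) (Space n) := fun i =>
    (μ i).withDensityᵥ fun _ => basisVec i
  let N : Fin n → VectorMeasure (Space n) (Space n) := fun i =>
    (ν i).withDensityᵥ fun _ => basisVec i
  have hP : ∀ i, IsFiniteMeasure (P i).variation := fun i =>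
    isFiniteMeasure_variation_withDensityᵥ (integrable_const _)
  have hN : ∀ i, IsFiniteMeasure (N i).variation := fun i =>
    isFiniteMeasure_variation_withDensityᵥ (integrable_const _)
  have hNP : ∀ i, IsFiniteMeasure (N i - P i).variation := fun i =>
    isFiniteMeasure_of_le _ VectorMeasure.variation_sub_le
  refine ⟨∑ i, (N i - P i), ?_, fun φ hφ hφc => ?_⟩
  · have : IsFiniteMeasure (∑ i, (N i - P i).variation) := by infer_instance
    exact isFiniteMeasure_of_le _ (VectorMeasure.variation_finsetSum_le _ _)
  obtain ⟨M, hM⟩ := hφc.exists_bound_of_continuous hφ.continuous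
  have hint : ∀ (m : Measure (Space n)) [IsFiniteMeasure m], Integrable φ m := fun m _ =>
    Integrable.of_bound hφ.continuous.aestronglyMeasurable M (Eventually.of_forall hM)
  rw [VectorMeasure.integral_finsetSum_vectorMeasure (fun i _ => hint _), ← Finset.sum_neg_distrib]
  have hterm : ∀ i, -∫ᵛ x, φ x ∂[innerSL ℝ; N i - P i] =
      ∫ x, φ x i ∂(μ i) - ∫ x, φ x i ∂(ν i) := by
    intro i
    rw [VectorMeasure.integral_sub_vectorMeasure (hint _) (hint _),
      integral_withDensityᵥ_inner (integrable_const _) hφ.continuous.stronglyMeasurable hM,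
      integral_withDensityᵥ_inner (integrable_const _) hφ.continuous.stronglyMeasurable hM, neg_sub]
    simp [basisVec, EuclideanSpace.inner_single_right]
  rw [Finset.sum_congr rfl fun i _ => hterm i]
  let Φ : Space n →ᵇ Space n := BoundedContinuousFunction.ofNormedAddCommGroup φ hφ.continuous M hM
  refine (hL ⟨Φ, hφ, hφc⟩).symm.trans ?_
  have hcc : ∀ i, Continuous fun x => φ x i := fun i =>
    (EuclideanSpace.proj (𝕜 := ℝ) i).continuous.comp hφ.continuous
  let Φi : Fin n → (Space n →ᵇ Space n) := fun i =>
    BoundedContinuousFunction.ofNormedAddCommGroup (fun x => φ x i • basisVec i)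
      ((hcc i).smul continuous_const) M fun x => by
        rw [norm_smul, basisVec, PiLp.norm_single, norm_one, mul_one]
        exact (PiLp.norm_apply_le (φ x) i).trans (hM x)
  have hsum : Φ = ∑ i, Φi i := by
    ext x j
    simp [Φ, Φi, basisVec, BoundedContinuousFunction.coe_sum, Pi.single_apply]
  change L Φ = _
  rw [hsum, map_sum]
  refine Finset.sum_congr rfl fun i _ => ?_
  exact hrep i (fun x => φ x i) (hcc i) (hφc.comp_left (g := fun v : Space n => v i) rfl) (Φi i)
    fun x => rfl

/-! ### Extension of the defining formula to Lipschitz fields -/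

/-- Averaging against a probability density does not increase a uniform bound; applied to values and
to increments, it preserves both M and L under mollification. -/
lemma norm_integral_normed_smul_le {n : ℕ} (b : ContDiffBump (0 : Space n)) {v : Space n → Space n}
    {B : ℝ} (hv : ∀ t, ‖v t‖ ≤ B) : ‖∫ t, b.normed volume t • v t‖ ≤ B := by
  have h := norm_integral_le_of_norm_le (b.integrable_normed (μ := volume) |>.mul_const B)
    (f := fun t => b.normed volume t • v t) (Eventually.of_forall fun t => by
      rw [norm_smul, Real.norm_of_nonneg (b.nonneg_normed t)]
      exact mul_le_mul_of_nonneg_left (hv t) (b.nonneg_normed t))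
  rwa [integral_mul_const, b.integral_normed, one_mul] at h

/-- Mollification of a Lipschitz vector field with uniform bounds. -/
lemma exists_smooth_approx {n : ℕ} {ψ : Space n → Space n} (hψ : Continuous ψ) {L M R : ℝ}
    (hLip : ∀ y z, ‖ψ (y + z) - ψ y‖ ≤ L * ‖z‖) (hM : ∀ y, ‖ψ y‖ ≤ M)
    (hR : ∀ y, R < ‖y‖ → ψ y = 0) :
    ∃ u : ℕ → Space n → Space n, (∀ k, ContDiff ℝ (⊤ : ℕ∞) (u k)) ∧
      (∀ k y z, ‖u k (y + z) - u k y‖ ≤ L * ‖z‖) ∧ (∀ k y, ‖u k y‖ ≤ M) ∧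
      (∀ k y, R + 1 < ‖y‖ → u k y = 0) ∧ ∀ y, Tendsto (fun k => u k y) atTop (𝓝 (ψ y)) := by
  let b : ℕ → ContDiffBump (0 : Space n) := fun k =>
    { rIn := 1 / (k + 1 : ℝ) / 2
      -- The radii tend to 0 and never exceed 1, so the supports stay in the ball of radius R + 1.
      rOut := 1 / (k + 1 : ℝ)
      rIn_pos := by positivity
      rIn_lt_rOut := half_lt_self (by positivity) }
  have hc : ∀ k y, convolution ((b k).normed volume) ψ (ContinuousLinearMap.lsmul ℝ ℝ) volume y =
      ∫ t, (b k).normed volume t • ψ (y - t) := fun k y => rfl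
  have hint : ∀ k y, Integrable fun t => (b k).normed volume t • ψ (y - t) := by
    intro k y
    refine Continuous.integrable_of_hasCompactSupport ?_ ?_
    · exact (b k).continuous_normed.smul (hψ.comp (continuous_const.sub continuous_id))
    · exact (b k).hasCompactSupport_normed.smul_right
  refine ⟨fun k => convolution ((b k).normed volume) ψ (ContinuousLinearMap.lsmul ℝ ℝ) volume,
    fun k => ?_, fun k y z => ?_, fun k y => ?_, fun k y hy => ?_, fun y => ?_⟩
  · exact (b k).hasCompactSupport_normed.contDiff_convolution_left _ (b k).contDiff_normed
      hψ.locallyIntegrable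
  · simp only [hc]
    rw [← integral_sub (hint k _) (hint k _)]
    simp_rw [← smul_sub]
    refine norm_integral_normed_smul_le (b k) fun t => ?_
    have := hLip (y - t) z
    rwa [show y - t + z = y + z - t by abel] at this
  · simp only [hc]
    exact norm_integral_normed_smul_le (b k) fun t => hM _
  · simp only [hc]
    refine integral_eq_zero_of_ae (Eventually.of_forall fun t => ?_)
    by_cases ht : t ∈ Function.support ((b k).normed volume)
    · rw [(b k).support_normed_eq, mem_ball_zero_iff] at ht
      have h1 : (b k).rOut ≤ 1 := by
        change 1 / ((k : ℝ) + 1) ≤ 1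
        rw [div_le_one (by positivity)]
        linarith [k.cast_nonneg (α := ℝ)]
      have h2 : R < ‖y - t‖ := by linarith [norm_sub_norm_le y t]
      simp [hR _ h2]
    · rw [Function.notMem_support] at ht
      simp [ht]
  · exact ContDiffBump.convolution_tendsto_right_of_continuous
      (tendsto_one_div_add_atTop_nhds_zero_nat (𝕜 := ℝ)) hψ y

/-- The defining integration by parts formula extends to Lipschitz fields of compact support. -/
theorem IsFracDerivative.integral_eq {n : ℕ} (hn : 1 ≤ n) {α : ℝ} (hα0 : 0 < α) (hα1 : α < 1)
    {p : ℝ≥0∞} (hp : 1 ≤ p) {f : Space n → ℝ} (hf : MemLp f p)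
    {D : VectorMeasure (Space n) (Space n)} (hD : IsFracDerivative α f D)
    {ψ : Space n → Space n} (hψ : ∃ K, LipschitzWith K ψ) (hψc : HasCompactSupport ψ) :
    ∫ y, f y * fracDiv α ψ y = -∫ᵛ y, ψ y ∂[innerSL ℝ; D] := by
  have hfin := hD.1
  have hcont := hψ.choose_spec.continuous
  obtain ⟨L, M, R, hL, hLip, hM, hR⟩ := exists_bounds_of_lipschitz hψ hψc
  obtain ⟨u, hu, huL, huM, huR, hlim⟩ := exists_smooth_approx hcont hLip hM hR
  have huc : ∀ k, HasCompactSupport (u k) := fun k =>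
    HasCompactSupport.intro (isCompact_closedBall (0 : Space n) (R + 1)) fun y hy =>
      huR k y (by rwa [mem_closedBall_zero_iff, not_le] at hy)
  -- Constants independent of k provide a single dominating function for all the mollified fields.
  have hb : ∀ k, DiffBound (L + 2 * M) (R + 1) (u k) := fun k =>
    diffBound_of_lipschitz hL (huL k) (huM k) (huR k)
  have hbψ : DiffBound (L + 2 * M) R ψ := diffBound_of_lipschitz hL hLip hM hR
  have hk := integrable_prod_mul_ballInd hp hf (integrable_min_norm_kernel hn hα0 hα1) (R + 1)
  have l1 : Tendsto (fun k => ∫ y, f y * fracDiv α (u k) y) atTop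
      (𝓝 (∫ y, f y * fracDiv α ψ y)) := by
    rw [hbψ.integral_mul_fracDiv hcont hn hα0 hα1 hp hf]
    simp_rw [fun k => (hb k).integral_mul_fracDiv (hu k).continuous hn hα0 hα1 hp hf]
    refine Tendsto.const_mul _ (tendsto_integral_of_dominated_convergence _
      (fun k => ((hb k).integrable_prod (hu k).continuous hn hα0 hα1 hp hf).1)
      (hk.const_mul (L + 2 * M)).norm
      (fun k => Eventually.of_forall fun q => ?_) (Eventually.of_forall fun q => ?_))
    · exact (hb k).norm_mul_inner_kernel_le α f q
    · exact tendsto_const_nhds.mul (tendsto_const_nhds.inner ((hlim _).sub (hlim _)))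
  have l2 : Tendsto (fun k => -∫ᵛ y, u k y ∂[innerSL ℝ; D]) atTop
      (𝓝 (-∫ᵛ y, ψ y ∂[innerSL ℝ; D])) :=
    (VectorMeasure.tendsto_integral_of_dominated_convergence (fun _ => M)
      (fun k => (hu k).continuous.aestronglyMeasurable) (integrable_const _)
      (fun k => Eventually.of_forall (huM k)) (Eventually.of_forall hlim)).neg
  refine tendsto_nhds_unique l1 (l2.congr fun k => ?_)
  exact (hD.2 (u k) (hu k) (huc k)).symm

/-! ### Characteristic functions of concentric balls, averaged in the radius -/

/-- The characteristic function of the ball of radius `s` about `x`. -/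
def chi {n : ℕ} (x : Space n) (s : ℝ) : Space n → ℝ := (Metric.ball x s).indicator 1

section Chi

variable {n : ℕ} (x : Space n)

lemma chi_eq (s : ℝ) (y : Space n) : chi x s y = (Ioi (dist y x)).indicator 1 s := by
  by_cases h : dist y x < s <;> simp [chi, h]

lemma chi_nonneg (s : ℝ) (y : Space n) : 0 ≤ chi x s y :=
  indicator_nonneg (fun _ _ => zero_le_one) _

lemma chi_le_one (s : ℝ) (y : Space n) : chi x s y ≤ 1 :=
  indicator_le_self' (fun _ _ => zero_le_one) _

lemma abs_chi_sub_le_one (s : ℝ) (a b : Space n) : |chi x s a - chi x s b| ≤ 1 := by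
  rw [abs_le]
  constructor <;> linarith [chi_nonneg x s a, chi_nonneg x s b, chi_le_one x s a, chi_le_one x s b]

lemma measurable_chi : Measurable (fun q : ℝ × Space n => chi x q.1 q.2) := by
  have : (fun q : ℝ × Space n => chi x q.1 q.2) =
      {q : ℝ × Space n | dist q.2 x < q.1}.indicator 1 := by
    ext q
    by_cases h : dist q.2 x < q.1 <;> simp [chi, h]
  rw [this]
  exact measurable_one.indicator (measurableSet_lt (by fun_prop) (by fun_prop))

lemma measurable_chi_comp {β : Type*} [MeasurableSpace β] {u : β → ℝ} {v : β → Space n}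
    (hu : Measurable u) (hv : Measurable v) : Measurable (fun b => chi x (u b) (v b)) := by
  have h := Measurable.comp (g := fun q : ℝ × Space n => chi x q.1 q.2) (measurable_chi x)
    (hu.prodMk hv)
  simpa only [Function.comp_def] using h

lemma abs_chi_sub_eq (s : ℝ) (a b : Space n) :
    |chi x s a - chi x s b| = (uIoc (dist a x) (dist b x)).indicator 1 s := by
  rw [chi_eq, chi_eq]
  rcases le_total (dist a x) (dist b x) with h | h
  · rw [uIoc_of_le h]
    by_cases h1 : dist a x < s <;> by_cases h2 : dist b x < s <;> simp [indicator, h1, h2]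
    linarith
  · rw [uIoc_of_ge h]
    by_cases h1 : dist a x < s <;> by_cases h2 : dist b x < s <;> simp [indicator, h1, h2]
    linarith

/-- The decisive estimate: the radii separating a from b lie between their distances to x, an
interval of length at most |a − b| by the triangle inequality. Averaging in the radius turns a jump
into a Lipschitz bound. -/
lemma integral_abs_chi_sub_le {σ : Measure ℝ} (hσ : σ ≤ volume) (a b : Space n) :
    ∫ s, |chi x s a - chi x s b| ∂σ ≤ dist a b := by
  simp_rw [abs_chi_sub_eq]
  rw [integral_indicator_one measurableSet_uIoc]
  refine (ENNReal.toReal_mono (by simp [uIoc]) (hσ _)).trans ?_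
  rw [Real.volume_uIoc, ENNReal.toReal_ofReal (abs_nonneg _), abs_sub_comm]
  exact abs_dist_sub_le _ _ _

variable {σ : Measure ℝ} [IsFiniteMeasure σ]

lemma integrable_chi (a : Space n) : Integrable (fun s => chi x s a) σ :=
  Integrable.of_bound (measurable_chi_comp x measurable_id measurable_const).aestronglyMeasurable 1
    (Eventually.of_forall fun s => by
      rw [Real.norm_of_nonneg (chi_nonneg x s a)]; exact chi_le_one x s a)

lemma integral_abs_chi_sub_le_min (hσ : σ ≤ volume) (y z : Space n) :
    ∫ s, |chi x s (y + z) - chi x s y| ∂σ ≤ (1 + σ.real univ) * min ‖z‖ 1 := by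
  have h0 : 0 ≤ σ.real univ := measureReal_nonneg
  rcases le_total ‖z‖ 1 with h | h
  · rw [min_eq_left h]
    have := integral_abs_chi_sub_le x hσ (y + z) y
    rw [dist_self_add_left] at this
    nlinarith [norm_nonneg z]
  · rw [min_eq_right h, mul_one]
    have h1 : ∫ s, |chi x s (y + z) - chi x s y| ∂σ ≤ ∫ _, (1 : ℝ) ∂σ :=
      integral_mono ((integrable_chi x _).sub (integrable_chi x _)).abs (integrable_const _)
        fun s => abs_chi_sub_le_one x s _ _
    rw [integral_const, smul_eq_mul, mul_one] at h1
    linarith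

/-- Integrability of the increments of characteristic functions of concentric balls against the
kernel, in all variables including the radius. -/
lemma integrable_chi_sub_smul_kernel (hn : 1 ≤ n) {α : ℝ} (hα0 : 0 < α) (hα1 : α < 1)
    (hσ : σ ≤ volume) {g : Space n → ℝ} (hg : Integrable g) :
    Integrable (fun q : ℝ × (Space n × Space n) =>
      (g q.2.1 * (chi x q.1 (q.2.1 + q.2.2) - chi x q.1 q.2.1)) • kernel α q.2.2)
      (σ.prod (volume.prod volume)) := by
  have hk := integrable_min_norm_kernel hn hα0 hα1
  have hm : AEStronglyMeasurable (fun q : ℝ × (Space n × Space n) =>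
      (g q.2.1 * (chi x q.1 (q.2.1 + q.2.2) - chi x q.1 q.2.1)) • kernel α q.2.2)
      (σ.prod (volume.prod volume)) := by
    have m1 : AEStronglyMeasurable (fun q : ℝ × (Space n × Space n) => g q.2.1)
        (σ.prod (volume.prod volume)) :=
      (hg.1.comp_fst (ν := (volume : Measure (Space n)))).comp_snd
    have m2 : Measurable (fun q : ℝ × (Space n × Space n) =>
        chi x q.1 (q.2.1 + q.2.2) - chi x q.1 q.2.1) :=
      (measurable_chi_comp x (by fun_prop) (by fun_prop)).sub
        (measurable_chi_comp x (by fun_prop) (by fun_prop))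
    have m3 : Measurable (fun q : ℝ × (Space n × Space n) => kernel α q.2.2) :=
      (measurable_kernel α).comp (measurable_snd.comp measurable_snd)
    exact (m1.mul m2.aestronglyMeasurable).smul m3.aestronglyMeasurable
  have hnorm : ∀ (q : Space n × Space n) (s : ℝ),
      ‖(g q.1 * (chi x s (q.1 + q.2) - chi x s q.1)) • kernel α q.2‖ =
        ‖g q.1‖ * ‖kernel α q.2‖ * |chi x s (q.1 + q.2) - chi x s q.1| := fun q s => by
    rw [norm_smul, norm_mul, Real.norm_eq_abs (_ - _)]; ring
  -- The radius is integrated first: this produces the factor min(|z|,1), which tames the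
  -- singularity of the kernel.
  rw [integrable_prod_iff' hm]
  refine ⟨Eventually.of_forall fun q => ?_, ?_⟩
  · have h := ((integrable_chi (σ := σ) x (q.1 + q.2)).sub (integrable_chi x q.1)).const_mul (g q.1)
    exact h.smul_const (kernel α q.2)
  · simp_rw [hnorm, integral_const_mul]
    refine ((hg.norm.mul_prod hk).const_mul (1 + σ.real univ)).mono' ?_
      (Eventually.of_forall fun q => ?_)
    · have := hm.norm.prod_swap.integral_prod_right'
      simpa only [Prod.swap, hnorm, integral_const_mul] using this
    · rw [Real.norm_of_nonneg (by positivity)]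
      refine (mul_le_mul_of_nonneg_left (integral_abs_chi_sub_le_min x hσ q.1 q.2)
        (by positivity)).trans (le_of_eq ?_)
      ring

/-- The field `y ↦ ∫ w(s) χ_{B_s}(y) φ(y) ds` is Lipschitz. -/
lemma lipschitz_integral_chi_smul (hσ : σ ≤ volume) {w : ℝ → ℝ} (hw : Continuous w) {A : ℝ}
    (hA : ∀ s, ‖w s‖ ≤ A) {φ : Space n → Space n} (hφ : ∃ K, LipschitzWith K φ) {M : ℝ}
    (hM : ∀ y, ‖φ y‖ ≤ M) :
    ∃ K, LipschitzWith K fun y => (∫ s, w s * chi x s y ∂σ) • φ y := by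
  have hA0 : 0 ≤ A := (norm_nonneg _).trans (hA 0)
  have hM0 : 0 ≤ M := (norm_nonneg _).trans (hM 0)
  have hint : ∀ y, Integrable (fun s => w s * chi x s y) σ := fun y =>
    (integrable_chi x y).bdd_mul (c := A) hw.aestronglyMeasurable (Eventually.of_forall hA)
  have h1 : ∀ a b, ‖(∫ s, w s * chi x s a ∂σ) - ∫ s, w s * chi x s b ∂σ‖ ≤ A * dist a b := by
    intro a b
    rw [← integral_sub (hint a) (hint b)]
    refine (norm_integral_le_of_norm_le (g := fun s => A * |chi x s a - chi x s b|)
      (((integrable_chi x _).sub (integrable_chi x _)).abs.const_mul A)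
      (Eventually.of_forall fun s => ?_)).trans ?_
    · rw [← mul_sub, norm_mul, Real.norm_eq_abs (_ - _)]
      exact mul_le_mul_of_nonneg_right (hA s) (abs_nonneg _)
    · rw [integral_const_mul]
      exact mul_le_mul_of_nonneg_left (integral_abs_chi_sub_le x hσ a b) hA0
  have h2 : ∀ a, ‖∫ s, w s * chi x s a ∂σ‖ ≤ A * σ.real univ := by
    intro a
    refine norm_integral_le_of_norm_le_const (Eventually.of_forall fun s => ?_)
    rw [norm_mul, Real.norm_of_nonneg (chi_nonneg x s a)]
    exact (mul_le_of_le_one_right (norm_nonneg _) (chi_le_one x s a)).trans (hA s)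
  obtain ⟨K, hK⟩ := hφ
  refine ⟨_, LipschitzWith.of_dist_le' (K := A * σ.real univ * K + A * M) fun a b => ?_⟩
  have e : (∫ s, w s * chi x s a ∂σ) • φ a - (∫ s, w s * chi x s b ∂σ) • φ b =
      (∫ s, w s * chi x s a ∂σ) • (φ a - φ b) +
        ((∫ s, w s * chi x s a ∂σ) - ∫ s, w s * chi x s b ∂σ) • φ b := by
    rw [smul_sub, sub_smul]; abel
  rw [dist_eq_norm, e]
  refine (norm_add_le _ _).trans ?_
  rw [norm_smul, norm_smul, add_mul]
  refine add_le_add ?_ ?_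
  · rw [mul_assoc]
    refine mul_le_mul (h2 a) ?_ (norm_nonneg _) (by positivity)
    rw [← dist_eq_norm]; exact hK.dist_le_mul a b
  · rw [mul_right_comm]
    exact mul_le_mul (h1 a b) (hM b) (norm_nonneg _) (by positivity)

end Chi

/-! ### The Leibniz rule and the three integrals on the left -/

section Leibniz

variable {n : ℕ} {α : ℝ} {f : Space n → ℝ} {φ : Space n → Space n} {x : Space n} {s : ℝ}

/-- The integrand `f(y) K(z) · (φ(y+z) - φ(y))` of `∫ f div^α φ`. -/
def divIncr (α : ℝ) (f : Space n → ℝ) (φ : Space n → Space n) (q : Space n × Space n) : ℝ :=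
  f q.1 * inner ℝ (kernel α q.2) (φ (q.1 + q.2) - φ q.1)

/-- The integrand of `∫ f φ · ∇^α χ_{B_s(x)}`. -/
def gradIncr (α : ℝ) (f : Space n → ℝ) (φ : Space n → Space n) (x : Space n) (s : ℝ)
    (q : Space n × Space n) : ℝ :=
  f q.1 * inner ℝ (φ q.1) ((chi x s (q.1 + q.2) - chi x s q.1) • kernel α q.2)

/-- The increment of a product ab is a·Δb + Δa·b + Δa·Δb. The three terms correspond to div^α φ on
the ball, to ∇^α χ and to the non-local divergence. -/
lemma leibniz_divIncr (q : Space n × Space n) :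
    divIncr α f (fun y => chi x s y • φ y) q = chi x s q.1 * divIncr α f φ q +
      gradIncr α f φ x s q + (chi x s (q.1 + q.2) - chi x s q.1) * divIncr α f φ q := by
  simp only [divIncr, gradIncr, inner_sub_right, real_inner_smul_right,
    real_inner_comm (φ q.1) (kernel α q.2)]
  ring

lemma integrable_chi_mul {G : Space n × Space n → ℝ} (hG : Integrable G (volume.prod volume)) :
    Integrable (fun q => chi x s q.1 * G q) (volume.prod volume) :=
  hG.bdd_mul (c := 1)
    (measurable_chi_comp x measurable_const measurable_fst).aestronglyMeasurable
    (Eventually.of_forall fun q => by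
      rw [Real.norm_of_nonneg (chi_nonneg x s _)]; exact chi_le_one x s _)

lemma integrable_chi_sub_mul {G : Space n × Space n → ℝ}
    (hG : Integrable G (volume.prod volume)) :
    Integrable (fun q => (chi x s (q.1 + q.2) - chi x s q.1) * G q) (volume.prod volume) :=
  hG.bdd_mul (c := 1)
    ((measurable_chi_comp x measurable_const (measurable_fst.add measurable_snd)).sub
      (measurable_chi_comp x measurable_const measurable_fst)).aestronglyMeasurable
    (Eventually.of_forall fun _ => abs_chi_sub_le_one x s _ _)

lemma DiffBound.setIntegral_mul_fracDiv {C R : ℝ} (hb : DiffBound C R φ) (hφ : Continuous φ)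
    (hn : 1 ≤ n) (hα0 : 0 < α) (hα1 : α < 1) {p : ℝ≥0∞} (hp : 1 ≤ p) (hf : MemLp f p) :
    ∫ y in Metric.ball x s, f y * fracDiv α φ y =
      mu n α * ∫ q, chi x s q.1 * divIncr α f φ q ∂(volume.prod volume) := by
  have hG : Integrable (divIncr α f φ) (volume.prod volume) :=
    hb.integrable_prod hφ hn hα0 hα1 hp hf
  rw [integral_prod _ (integrable_chi_mul hG), ← integral_indicator Metric.isOpen_ball.measurableSet,
    ← integral_const_mul]
  refine integral_congr_ae (Eventually.of_forall fun y => ?_)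
  simp only
  rw [integral_const_mul]
  have e := congrFun (hb.mul_fracDiv_eq hφ hn hα0 hα1 f) y
  by_cases hy : y ∈ Metric.ball x s
  · rw [indicator_of_mem hy, e, chi, indicator_of_mem hy, Pi.one_apply, one_mul]
    rfl
  · rw [indicator_of_notMem hy, chi, indicator_of_notMem hy, zero_mul, mul_zero]

lemma mul_fracDivNL_eq (y : Space n) :
    f y * fracDivNL α (chi x s) φ y =
      mu n α * ∫ z, (chi x s (y + z) - chi x s y) * divIncr α f φ (y, z) := by
  rw [fracDivNL_eq, mul_left_comm, ← integral_const_mul]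
  congr 2 with z
  simp only [divIncr]
  ring

lemma integrable_mul_fracDivNL (hG : Integrable (divIncr α f φ) (volume.prod volume)) :
    Integrable fun y => f y * fracDivNL α (chi x s) φ y := by
  simp_rw [mul_fracDivNL_eq]
  exact (integrable_chi_sub_mul hG).integral_prod_left.const_mul _

lemma integral_mul_fracDivNL (hG : Integrable (divIncr α f φ) (volume.prod volume)) :
    ∫ y, f y * fracDivNL α (chi x s) φ y = mu n α *
      ∫ q, (chi x s (q.1 + q.2) - chi x s q.1) * divIncr α f φ q ∂(volume.prod volume) := by
  simp_rw [mul_fracDivNL_eq]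
  rw [integral_const_mul, integral_prod _ (integrable_chi_sub_mul hG)]

lemma norm_gradIncr_le (q : Space n × Space n) :
    ‖gradIncr α f φ x s q‖ ≤
      ‖((f q.1 * ‖φ q.1‖) * (chi x s (q.1 + q.2) - chi x s q.1)) • kernel α q.2‖ := by
  rw [gradIncr, mul_smul, norm_mul, norm_smul, norm_mul, norm_norm, mul_assoc]
  exact mul_le_mul_of_nonneg_left (norm_inner_le_norm _ _) (norm_nonneg _)

/-- For a.e. y the section in z is integrable. Where f(y)|φ(y)| ≠ 0, dividing by it gives integrable
increments of χ, so `fracGrad_eq` applies; elsewhere both sides vanish, whatever the value of the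
gradient. -/
lemma mul_inner_fracGrad_ae_eq (hn : 1 ≤ n) (hα0 : 0 < α) (hα1 : α < 1)
    (hV : Integrable (fun q : Space n × Space n =>
      ((f q.1 * ‖φ q.1‖) * (chi x s (q.1 + q.2) - chi x s q.1)) • kernel α q.2)
      (volume.prod volume)) :
    (fun y => f y * inner ℝ (φ y) (fracGrad α (chi x s) y)) =ᵐ[volume]
      fun y => mu n α * ∫ z, gradIncr α f φ x s (y, z) := by
  filter_upwards [hV.prod_right_ae] with y hy
  simp only [gradIncr]
  rw [integral_const_mul]
  by_cases h0 : f y * ‖φ y‖ = 0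
  · rcases mul_eq_zero.1 h0 with h | h
    · simp [h]
    · simp [norm_eq_zero.1 h]
  have hy' : Integrable fun z => (chi x s (y + z) - chi x s y) • kernel α z := by
    refine (hy.smul (f y * ‖φ y‖)⁻¹).congr (Eventually.of_forall fun z => ?_)
    simp only [Pi.smul_apply, smul_smul]
    rw [inv_mul_cancel_left₀ h0]
  rw [fracGrad_eq hn hα0 hα1 hy', real_inner_smul_right, integral_inner hy', mul_left_comm]

lemma aestronglyMeasurable_gradIncr (σ : Measure ℝ) (hf : AEStronglyMeasurable f)
    (hφ : Continuous φ) :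
    AEStronglyMeasurable (fun q : ℝ × (Space n × Space n) => gradIncr α f φ x q.1 q.2)
      (σ.prod (volume.prod volume)) := by
  have m1 : AEStronglyMeasurable (fun q : ℝ × (Space n × Space n) => f q.2.1)
      (σ.prod (volume.prod volume)) :=
    (hf.comp_fst (ν := (volume : Measure (Space n)))).comp_snd
  have m2 : Measurable (fun q : ℝ × (Space n × Space n) =>
      chi x q.1 (q.2.1 + q.2.2) - chi x q.1 q.2.1) :=
    (measurable_chi_comp x (by fun_prop) (by fun_prop)).sub
      (measurable_chi_comp x (by fun_prop) (by fun_prop))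
  have m3 : Measurable (fun q : ℝ × (Space n × Space n) => kernel α q.2.2) :=
    (measurable_kernel α).comp (measurable_snd.comp measurable_snd)
  have m4 : Measurable (fun q : ℝ × (Space n × Space n) => φ q.2.1) := by fun_prop
  exact m1.mul (m4.inner (m2.smul m3)).aestronglyMeasurable

lemma integrable_gradIncr_section (hf : AEStronglyMeasurable f) (hφ : Continuous φ)
    (hV : Integrable (fun q : Space n × Space n =>
      ((f q.1 * ‖φ q.1‖) * (chi x s (q.1 + q.2) - chi x s q.1)) • kernel α q.2)
      (volume.prod volume)) : Integrable (gradIncr α f φ x s) (volume.prod volume) := by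
  refine hV.norm.mono' ?_ (Eventually.of_forall norm_gradIncr_le)
  have m2 : Measurable (fun q : Space n × Space n => chi x s (q.1 + q.2) - chi x s q.1) :=
    (measurable_chi_comp x measurable_const (by fun_prop)).sub
      (measurable_chi_comp x measurable_const (by fun_prop))
  have m3 : Measurable (fun q : Space n × Space n => kernel α q.2) :=
    (measurable_kernel α).comp measurable_snd
  have m4 : Measurable (fun q : Space n × Space n => φ q.1) := by fun_prop
  exact hf.comp_fst.mul (m4.inner (m2.smul m3)).aestronglyMeasurable

lemma integrable_mul_inner_fracGrad (hn : 1 ≤ n) (hα0 : 0 < α) (hα1 : α < 1)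
    (hf : AEStronglyMeasurable f) (hφ : Continuous φ)
    (hV : Integrable (fun q : Space n × Space n =>
      ((f q.1 * ‖φ q.1‖) * (chi x s (q.1 + q.2) - chi x s q.1)) • kernel α q.2)
      (volume.prod volume)) :
    Integrable fun y => f y * inner ℝ (φ y) (fracGrad α (chi x s) y) :=
  ((integrable_gradIncr_section hf hφ hV).integral_prod_left.const_mul _).congr
    (mul_inner_fracGrad_ae_eq hn hα0 hα1 hV).symm

lemma integral_mul_inner_fracGrad (hn : 1 ≤ n) (hα0 : 0 < α) (hα1 : α < 1)
    (hf : AEStronglyMeasurable f) (hφ : Continuous φ)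
    (hV : Integrable (fun q : Space n × Space n =>
      ((f q.1 * ‖φ q.1‖) * (chi x s (q.1 + q.2) - chi x s q.1)) • kernel α q.2)
      (volume.prod volume)) :
    ∫ y, f y * inner ℝ (φ y) (fracGrad α (chi x s) y) =
      mu n α * ∫ q, gradIncr α f φ x s q ∂(volume.prod volume) := by
  rw [integral_congr_ae (mul_inner_fracGrad_ae_eq hn hα0 hα1 hV), integral_const_mul,
    integral_prod _ (integrable_gradIncr_section hf hφ hV)]

/-- Joint integrability in the radius of the integrand of `div^α (χ_{B_s(x)} φ)`. -/
lemma integrable_divIncr_chi_smul {σ : Measure ℝ} [IsFiniteMeasure σ]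
    (hf : AEStronglyMeasurable f) (hφ : Continuous φ)
    (hG : Integrable (divIncr α f φ) (volume.prod volume))
    (hV : Integrable (fun q : ℝ × (Space n × Space n) =>
      ((f q.2.1 * ‖φ q.2.1‖) * (chi x q.1 (q.2.1 + q.2.2) - chi x q.1 q.2.1)) • kernel α q.2.2)
      (σ.prod (volume.prod volume))) :
    Integrable (fun q : ℝ × (Space n × Space n) => divIncr α f (fun y => chi x q.1 y • φ y) q.2)
      (σ.prod (volume.prod volume)) := by
  simp_rw [leibniz_divIncr]
  have hG' : Integrable (fun q : ℝ × (Space n × Space n) => divIncr α f φ q.2)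
    (σ.prod (volume.prod volume)) := hG.comp_snd σ
  have h2 : Integrable (fun q : ℝ × (Space n × Space n) => gradIncr α f φ x q.1 q.2)
      (σ.prod (volume.prod volume)) :=
    hV.norm.mono' (aestronglyMeasurable_gradIncr σ hf hφ)
      (Eventually.of_forall fun q => norm_gradIncr_le q.2)
  refine ((hG'.bdd_mul (c := 1)
    (measurable_chi_comp x measurable_fst (by fun_prop)).aestronglyMeasurable
    (Eventually.of_forall fun q => ?_)).add h2).add (hG'.bdd_mul (c := 1)
    ((measurable_chi_comp x measurable_fst (by fun_prop)).sub
      (measurable_chi_comp x measurable_fst (by fun_prop))).aestronglyMeasurable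
    (Eventually.of_forall fun q => abs_chi_sub_le_one x _ _ _))
  rw [Real.norm_of_nonneg (chi_nonneg x _ _)]; exact chi_le_one x _ _

end Leibniz

/-! ### Integration by parts for χ_s φ, for almost every radius -/

lemma integrable_mul_norm_of_hasCompactSupport {n : ℕ} {p : ℝ≥0∞} (hp : 1 ≤ p)
    {f : Space n → ℝ} (hf : MemLp f p) {φ : Space n → Space n} (hφ : Continuous φ)
    (hφc : HasCompactSupport φ) : Integrable fun y => f y * ‖φ y‖ := by
  have h := (hf.locallyIntegrable hp).integrable_smul_left_of_hasCompactSupport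
    (g := fun y => ‖φ y‖) hφ.norm hφc.norm
  refine h.congr (Eventually.of_forall fun y => ?_)
  simp [mul_comm]

lemma integral_mul_divIncr_chi_smul {n : ℕ} {α : ℝ} {f : Space n → ℝ} {φ : Space n → Space n}
    {x : Space n} {σ : Measure ℝ} [IsFiniteMeasure σ] {w : ℝ → ℝ} (hw : Continuous w) {A : ℝ}
    (hA : ∀ s, ‖w s‖ ≤ A) (q : Space n × Space n) :
    ∫ s, w s * divIncr α f (fun y => chi x s y • φ y) q ∂σ =
      divIncr α f (fun y => (∫ s, w s * chi x s y ∂σ) • φ y) q := by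
  have hint : ∀ y, Integrable (fun s => w s * chi x s y) σ := fun y =>
    (integrable_chi x y).bdd_mul (c := A) hw.aestronglyMeasurable (Eventually.of_forall hA)
  simp only [divIncr, inner_sub_right, real_inner_smul_right]
  rw [mul_sub, mul_left_comm, mul_left_comm (f q.1) (∫ s, w s * chi x s q.1 ∂σ),
    ← integral_mul_const, ← integral_mul_const,
    ← integral_sub ((hint _).mul_const _) ((hint _).mul_const _)]
  refine integral_congr_ae (Eventually.of_forall fun s => ?_)
  simp only
  ring

/-- The field χ_s φ is not Lipschitz, but its averages in s against smooth weights are. Both sides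
are integrable in s and have equal integrals against every such weight, so they agree almost
everywhere. -/
lemma IsFracDerivative.ae_integral_divIncr_eq {n : ℕ} (hn : 1 ≤ n) {α : ℝ} (hα0 : 0 < α)
    (hα1 : α < 1) {p : ℝ≥0∞} (hp : 1 ≤ p) {f : Space n → ℝ} (hf : MemLp f p)
    {D : VectorMeasure (Space n) (Space n)} (hD : IsFracDerivative α f D)
    {φ : Space n → Space n} (hφ : ∃ K, LipschitzWith K φ) (hφc : HasCompactSupport φ)
    (x : Space n) {σ : Measure ℝ} [IsFiniteMeasure σ] (hσ : σ ≤ volume)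
    (hΦ : Integrable (fun q : ℝ × (Space n × Space n) =>
      divIncr α f (fun y => chi x q.1 y • φ y) q.2) (σ.prod (volume.prod volume))) :
    ∀ᵐ s ∂σ, mu n α * ∫ q, divIncr α f (fun y => chi x s y • φ y) q ∂(volume.prod volume) =
      -∫ᵛ y in Metric.ball x s, φ y ∂[innerSL ℝ; D] := by
  have hfin := hD.1
  have hcont := hφ.choose_spec.continuous
  obtain ⟨L, M, R, hL, hLip, hM, hR⟩ := exists_bounds_of_lipschitz hφ hφc
  obtain ⟨h, hh, hrep⟩ := exists_integral_eq_integral_inner D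
  have hinner : Integrable (fun y => inner ℝ (φ y) (h y)) D.variation := by
    refine (hh.norm.const_mul M).mono'
      (hcont.aestronglyMeasurable.inner hh.1) (Eventually.of_forall fun y => ?_)
    exact (norm_inner_le_norm _ _).trans (mul_le_mul_of_nonneg_right (hM y) (norm_nonneg _))
  have hball : ∀ s, ∫ᵛ y in Metric.ball x s, φ y ∂[innerSL ℝ; D] =
      ∫ y, chi x s y * inner ℝ (φ y) (h y) ∂D.variation := by
    intro s
    rw [← VectorMeasure.integral_indicator Metric.isOpen_ball.measurableSet,
      hrep _ M (hcont.stronglyMeasurable.indicator Metric.isOpen_ball.measurableSet)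
        fun y => (norm_indicator_le_norm_self _ _).trans (hM y)]
    refine integral_congr_ae (Eventually.of_forall fun y => ?_)
    by_cases hy : y ∈ Metric.ball x s <;> simp only [chi, indicator, hy] <;> simp
  simp_rw [hball]
  have hJ : Integrable (fun q : ℝ × Space n => chi x q.1 q.2 * inner ℝ (φ q.2) (h q.2))
      (σ.prod D.variation) :=
    (hinner.comp_snd σ).bdd_mul (c := 1) (measurable_chi_comp x measurable_fst measurable_snd).aestronglyMeasurable
      (Eventually.of_forall fun q => by
        rw [Real.norm_of_nonneg (chi_nonneg x _ _)]; exact chi_le_one x _ _)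
  have hF1 : Integrable (fun s => mu n α *
      ∫ q, divIncr α f (fun y => chi x s y • φ y) q ∂(volume.prod volume)) σ :=
    hΦ.integral_prod_left.const_mul _
  have hF2 : Integrable (fun s => ∫ y, chi x s y * inner ℝ (φ y) (h y) ∂D.variation) σ :=
    hJ.integral_prod_left
  have key := ae_eq_zero_of_integral_contDiff_smul_eq_zero (hF1.add hF2).locallyIntegrable
    fun w hw hwc => ?_
  · filter_upwards [key] with s hs
    exact eq_neg_of_add_eq_zero_left hs
  obtain ⟨A, hA⟩ := hwc.exists_bound_of_continuous hw.continuous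
  have hwm : ∀ {β : Type} [MeasurableSpace β] (τ : Measure (ℝ × β)),
      AEStronglyMeasurable (fun q : ℝ × β => w q.1) τ := fun τ =>
    (hw.continuous.measurable.comp measurable_fst).aestronglyMeasurable
  have hwF1 := hF1.bdd_mul (c := A) hw.continuous.aestronglyMeasurable (Eventually.of_forall hA)
  have hwF2 := hF2.bdd_mul (c := A) hw.continuous.aestronglyMeasurable (Eventually.of_forall hA)
  simp only [Pi.add_apply, smul_eq_mul, mul_add]
  rw [integral_add hwF1 hwF2]
  have hψ := lipschitz_integral_chi_smul x hσ hw.continuous hA hφ hM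
  have hψc : HasCompactSupport fun y => (∫ s, w s * chi x s y ∂σ) • φ y :=
    HasCompactSupport.smul_left (f := fun y => ∫ s, w s * chi x s y ∂σ) hφc
  obtain ⟨C', R', hb⟩ := exists_diffBound hψ hψc
  have hψcont := hψ.choose_spec.continuous
  -- Fubini moves the average in s onto the field, in which the increment is linear; `e2` does the
  -- same on the side of D.
  have e1 : ∫ s, w s * (mu n α *
      ∫ q, divIncr α f (fun y => chi x s y • φ y) q ∂(volume.prod volume)) ∂σ =
      ∫ y, f y * fracDiv α (fun y => (∫ s, w s * chi x s y ∂σ) • φ y) y := by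
    rw [hb.integral_mul_fracDiv hψcont hn hα0 hα1 hp hf]
    simp_rw [mul_left_comm (w _) (mu n α), ← integral_const_mul (w _)]
    rw [integral_const_mul, integral_integral_swap]
    · simp_rw [integral_mul_divIncr_chi_smul hw.continuous hA]
      rfl
    · exact hΦ.bdd_mul (c := A) (hwm _) (Eventually.of_forall fun q => hA q.1)
  have e2 : ∫ s, w s * ∫ y, chi x s y * inner ℝ (φ y) (h y) ∂D.variation ∂σ =
      ∫ᵛ y, (∫ s, w s * chi x s y ∂σ) • φ y ∂[innerSL ℝ; D] := by
    obtain ⟨M', hM'⟩ := hψc.exists_bound_of_continuous hψcont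
    rw [hrep _ M' hψcont.stronglyMeasurable hM']
    simp_rw [← integral_const_mul (w _)]
    rw [integral_integral_swap]
    · simp_rw [← mul_assoc, integral_mul_const, real_inner_smul_left]
    · exact hJ.bdd_mul (c := A) (hwm _) (Eventually.of_forall fun q => hA q.1)
  rw [e1, e2, hD.integral_eq hn hα0 hα1 hp hf hψ hψc, neg_add_cancel]

/-- Only the defining property of the chosen measure matters below; its uniqueness plays no role. -/
lemma isFracDerivative_fracDerivative {n : ℕ} (hn : 1 ≤ n) {α : ℝ} (hα0 : 0 < α) (hα1 : α < 1)
    {p : ℝ≥0∞} (hp : 1 ≤ p) {f : Space n → ℝ} (hf : MemBV α p f) :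
    IsFracDerivative α f (fracDerivative α f) := by
  have h := exists_isFracDerivative hn hα0 hα1 hp hf
  rw [fracDerivative, dif_pos h]
  exact h.choose_spec

end FracBV

end

/-! ### The theorem -/

theorem mainTheorem9 {n : ℕ} (hn : 1 ≤ n) (α : ℝ) (hα0 : 0 < α) (hα1 : α < 1)
    (p : ℝ≥0∞) (hp : ENNReal.ofReal (1 / (1 - α)) < p)
    (f : EuclideanSpace ℝ (Fin n) → ℝ) (hf : FracBV.MemBV α p f)
    (φ : EuclideanSpace ℝ (Fin n) → EuclideanSpace ℝ (Fin n))
    (hφ : ∃ K, LipschitzWith K φ) (hφc : HasCompactSupport φ)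
    (x : EuclideanSpace ℝ (Fin n)) :
    ∀ᵐ r ∂((volume : Measure ℝ).restrict (Ioi 0)),
      IntegrableOn (fun y => f y * FracBV.fracDiv α φ y) (Metric.ball x r) volume ∧
      Integrable (fun y => f y *
        inner ℝ (φ y) (FracBV.fracGrad α ((Metric.ball x r).indicator 1) y)) volume ∧
      Integrable (fun y => f y *
        FracBV.fracDivNL α ((Metric.ball x r).indicator 1) φ y) volume ∧
      (FracBV.fracDerivative α f).IntegrableOn φ (Metric.ball x r) ∧
      (∫ y in Metric.ball x r, f y * FracBV.fracDiv α φ y)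
        + (∫ y, f y * inner ℝ (φ y) (FracBV.fracGrad α ((Metric.ball x r).indicator 1) y))
        + (∫ y, f y * FracBV.fracDivNL α ((Metric.ball x r).indicator 1) φ y)
      = - ∫ᵛ y in Metric.ball x r, φ y ∂[innerSL ℝ; FracBV.fracDerivative α f] := by
  have hp1 : 1 ≤ p := by
    refine le_trans ?_ hp.le
    rw [← ENNReal.ofReal_one]
    refine ENNReal.ofReal_le_ofReal ?_
    rw [le_div_iff₀ (by linarith)]
    linarith
  have hcont := hφ.choose_spec.continuous
  have hD := FracBV.isFracDerivative_fracDerivative hn hα0 hα1 hp1 hf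
  have hfin := hD.1
  obtain ⟨C, R, hb⟩ := FracBV.exists_diffBound hφ hφc
  have hG : Integrable (FracBV.divIncr α f φ) (volume.prod volume) :=
    hb.integrable_prod hcont hn hα0 hα1 hp1 hf.1
  obtain ⟨M, hM⟩ := hφc.exists_bound_of_continuous hcont
  have hφD : (FracBV.fracDerivative α f).Integrable φ :=
    Integrable.of_bound hcont.aestronglyMeasurable M (Eventually.of_forall hM)
  have hcover : (⋃ N : ℕ, Ioo (-(N : ℝ)) N) = univ := by
    refine eq_univ_of_forall fun s => ?_
    obtain ⟨N, hN⟩ := exists_nat_gt |s|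
    exact mem_iUnion.2 ⟨N, abs_lt.1 hN⟩
  -- The claim is proved for a.e. real r, on each interval (−N,N): the averaging lemmas need a
  -- finite measure of radii, and countably many intervals cover the line.
  refine ae_restrict_of_ae ?_
  rw [← Measure.restrict_univ (μ := (volume : Measure ℝ)), ← hcover, ae_restrict_iUnion_iff]
  intro N
  have hV := FracBV.integrable_chi_sub_smul_kernel x hn hα0 hα1
    (σ := volume.restrict (Ioo (-(N : ℝ)) N)) Measure.restrict_le_self
    (FracBV.integrable_mul_norm_of_hasCompactSupport hp1 hf.1 hcont hφc)
  have hΦ := FracBV.integrable_divIncr_chi_smul hf.1.1 hcont hG hV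
  filter_upwards [hV.prod_right_ae, hD.ae_integral_divIncr_eq hn hα0 hα1 hp1 hf.1 hφ hφc x
    Measure.restrict_le_self hΦ] with s hVs hs
  refine ⟨(hb.integrable_mul_fracDiv hcont hn hα0 hα1 hp1 hf.1).integrableOn,
    FracBV.integrable_mul_inner_fracGrad hn hα0 hα1 hf.1.1 hcont hVs,
    FracBV.integrable_mul_fracDivNL hG, hφD.integrableOn, ?_⟩
  have hgr := FracBV.integrable_gradIncr_section hf.1.1 hcont hVs
  have h12 : Integrable (fun q => FracBV.chi x s q.1 * FracBV.divIncr α f φ q +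
      FracBV.gradIncr α f φ x s q) (volume.prod volume) := (FracBV.integrable_chi_mul hG).add hgr
  refine Eq.trans ?_ hs
  rw [hb.setIntegral_mul_fracDiv hcont hn hα0 hα1 hp1 hf.1]
  refine (congrArg₂ (· + ·) (congrArg₂ (· + ·) rfl
    (FracBV.integral_mul_inner_fracGrad hn hα0 hα1 hf.1.1 hcont hVs))
    (FracBV.integral_mul_fracDivNL hG)).trans ?_
  -- Each integral on the left is now μ times a double integral, and the Leibniz rule identifies
  -- their sum with that of χ_s φ.
  simp_rw [FracBV.leibniz_divIncr]
  rw [integral_add h12 (FracBV.integrable_chi_sub_mul hG),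
    integral_add (FracBV.integrable_chi_mul hG) hgr, mul_add, mul_add]
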